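/- **Proposition (Transience of the walker).** A state is a pair $(T,x)$, where $T$ is a locally finite tree (every vertex has finite degree), finite or infinite, with vertex set $V(T)\subset\mathbb{N}$ such that $\mathbb{N}\setminus V(T)$ is infinite, and $x\in V(T)$. The set of states carries the trace of the product $\sigma$-algebra, a state being described by the indicators of its vertices and edges and by $x$. For $p\in(0,1]$ the Bernoulli growth random walk (BGRW) with parameter $p$ is the Markov chain $(T_n,X_n)_{n\ge 0}$ on the set of states whose transition kernel $K_p$ is as follows. From $(T,x)$: 1. let $m=\min(\mathbb{N}\setminus V(T))$; with probability $p$ let $T'$ be $T$ with the new vertex $m$ and the new edge $\{m,x\}$ added, and with probability $1-p$ let $T'=T$; 2. conditionally on step 1, let $x'$ be a uniformly chosen neighbour of $x$ in $T'$ (if $x$ has no neighbour in $T'$, that is, if $T'$ has a single vertex, let $x'=x$). The new state is $(T',x')$. Let $\mathbb{P}_{T_0,x_0,p}$ denote the law of the chain started from $(T_0,x_0)$, and let $\mathrm{dist}_T$ denote the graph distance in $T$. For every $p\in(0,1]$ there is a constant $c>0$, depending on $p$ only, such that for every state $(T_0,x_0)$ and every vertex $\mathrm{root}\in V(T_0)$,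 $$\liminf_{n\to\infty}\frac{\mathrm{dist}_{T_n}(X_n,\mathrm{root})}{n}\ \ge\ c\qquad \mathbb{P}_{T_0,x_0,p}\text{-almost surely.}$$ -/

import Mathlib

open Filter MeasureTheory ProbabilityTheory SimpleGraph
open scoped ENNReal

noncomputable section

namespace BGRW

/-- A state `(T, x)` of the Bernoulli growth random walk: a locally finite tree `T` whose vertex
set is a subset of `ℕ` with infinite complement, together with a vertex `x` of `T`, the position
of the walker. The tree is a subgraph of the complete graph on `ℕ`. -/
@[ext]
structure State where
  /-- the tree `T` -/
  tree : (⊤ : SimpleGraph ℕ).Subgraph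
  /-- the position `x` of the walker -/
  walker : ℕ
  isTree : tree.coe.IsTree
  locallyFinite : ∀ v, (tree.neighborSet v).Finite
  infinite_compl : (tree.vertsᶜ).Infinite
  walker_mem : walker ∈ tree.verts

namespace State

/-- The description of a state by the indicators of its vertices and of its edges and by the
position of the walker. -/
def code (s : State) : (ℕ → Prop) × (ℕ → ℕ → Prop) × ℕ :=
  (fun v => v ∈ s.tree.verts, fun u v => s.tree.Adj u v, s.walker)

/-- The `σ`-algebra on the set of states is the trace of the product `σ`-algebra. -/
instance : MeasurableSpace State := MeasurableSpace.comap code inferInstance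

/-- The graph distance in the tree of the state `s` between the vertices `u` and `v`. -/
def dist (s : State) (u v : ℕ) : ℕ := s.tree.spanningCoe.dist u v

/-- The smallest natural number that is not a vertex of the tree. -/
def newVertex (s : State) : ℕ := sInf (s.tree.vertsᶜ)

lemma newVertex_notMem (s : State) : s.newVertex ∉ s.tree.verts :=
  Nat.sInf_mem s.infinite_compl.nonempty

lemma walker_adj_newVertex (s : State) : (⊤ : SimpleGraph ℕ).Adj s.walker s.newVertex := by
  rw [top_adj]
  intro h
  exact s.newVertex_notMem (h ▸ s.walker_mem)

/-- The tree with the new vertex attached to the position of the walker. -/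
def grownTree (s : State) : (⊤ : SimpleGraph ℕ).Subgraph :=
  s.tree ⊔ (⊤ : SimpleGraph ℕ).subgraphOfAdj s.walker_adj_newVertex

lemma mem_verts_grownTree (s : State) (v : ℕ) :
    v ∈ s.grownTree.verts ↔ v ∈ s.tree.verts ∨ v = s.newVertex := by
  have := s.walker_mem
  simp only [grownTree, Subgraph.verts_sup, subgraphOfAdj_verts, Set.mem_union,
    Set.mem_insert_iff, Set.mem_singleton_iff]
  constructor
  · rintro (h | h | h)
    · exact Or.inl h
    · exact Or.inl (h ▸ this)
    · exact Or.inr h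
  · tauto

lemma adj_grownTree (s : State) (u v : ℕ) :
    s.grownTree.Adj u v ↔ s.tree.Adj u v ∨ (u = s.walker ∧ v = s.newVertex) ∨
      (u = s.newVertex ∧ v = s.walker) := by
  simp only [grownTree, Subgraph.sup_adj, subgraphOfAdj_adj, Sym2.eq_iff]
  tauto

lemma isAcyclic_spanningCoe (T : (⊤ : SimpleGraph ℕ).Subgraph) (h : T.coe.IsAcyclic) :
    T.spanningCoe.IsAcyclic := by
  rw [isAcyclic_iff_forall_adj_isBridge] at h ⊢
  intro u v huv
  rw [Subgraph.spanningCoe_adj] at huv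
  have h1 := h (v := ⟨u, T.edge_vert huv⟩) (w := ⟨v, T.edge_vert huv.symm⟩) huv
  rw [isBridge_iff] at h1 ⊢
  intro hr
  apply h1
  rw [reachable_iff_reflTransGen] at hr
  have key : ∀ w, Relation.ReflTransGen (T.spanningCoe.deleteEdges {s(u, v)}).Adj u w →
      ∃ hw : w ∈ T.verts, (T.coe.deleteEdges
        {s(⟨u, T.edge_vert huv⟩, ⟨v, T.edge_vert huv.symm⟩)}).Reachable
          ⟨u, T.edge_vert huv⟩ ⟨w, hw⟩ := by
    intro w hw
    induction hw with
    | refl => exact ⟨T.edge_vert huv, Reachable.refl _⟩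
    | tail _ hab ih =>
      obtain ⟨hb, hreach⟩ := ih
      rw [deleteEdges_adj, Subgraph.spanningCoe_adj] at hab
      refine ⟨T.edge_vert hab.1.symm, hreach.trans (Adj.reachable ?_)⟩
      rw [deleteEdges_adj]
      refine ⟨hab.1, fun hh => hab.2 ?_⟩
      simp only [Set.mem_singleton_iff, Sym2.eq_iff, Subtype.mk.injEq] at hh ⊢
      exact hh
  exact (key v hr).2

lemma isTree_grownTree (s : State) : s.grownTree.coe.IsTree := by
  constructor
  · have h1 : s.tree.Preconnected := ⟨s.isTree.1.preconnected⟩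
    have h2 := (Subgraph.subgraphOfAdj_connected s.walker_adj_newVertex).preconnected
    have h3 := Subgraph.connected_sup h1 h2 ⟨s.walker, s.walker_mem, by simp⟩
    exact h3.coe
  · have h1 := isAcyclic_spanningCoe _ s.isTree.2
    have h2 : s.grownTree.spanningCoe = s.tree.spanningCoe ⊔ edge s.walker s.newVertex := by
      ext u v
      have := s.walker_adj_newVertex.ne
      simp only [Subgraph.spanningCoe_adj, adj_grownTree, sup_adj, edge_adj]
      grind
    have h3 : ¬ s.tree.spanningCoe.Reachable s.walker s.newVertex := by
      apply not_reachable_of_neighborSet_right_eq_empty s.walker_adj_newVertex.ne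
      ext v
      simp only [mem_neighborSet, Subgraph.spanningCoe_adj, Set.mem_empty_iff_false, iff_false]
      exact fun h => s.newVertex_notMem (s.tree.edge_vert h)
    have h4 : s.grownTree.spanningCoe.IsAcyclic := h2 ▸ h1.sup_edge_of_not_reachable h3
    exact h4.comap ⟨Subtype.val, fun h => h⟩ Subtype.val_injective

/-- Growth: the least unused natural number becomes a new leaf attached to the walker's
position. -/
def grow (s : State) : State where
  tree := s.grownTree
  walker := s.walker
  isTree := s.isTree_grownTree
  locallyFinite v := by
    refine ((s.locallyFinite v).union (Set.toFinite {s.newVertex, s.walker})).subset ?_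
    intro w hw
    have := (s.adj_grownTree v w).1 hw
    simp only [Set.mem_union, Set.mem_insert_iff, Set.mem_singleton_iff]
    rcases this with h | h | h
    · exact Or.inl h
    · exact Or.inr (Or.inl h.2)
    · exact Or.inr (Or.inr h.2)
  infinite_compl := by
    refine (s.infinite_compl.sdiff (Set.finite_singleton s.newVertex)).mono ?_
    intro v hv hv'
    rcases (s.mem_verts_grownTree v).1 hv' with h | h
    · exact hv.1 h
    · exact hv.2 h
  walker_mem := (s.mem_verts_grownTree _).2 (Or.inl s.walker_mem)

open Classical in
/-- Displacement of the walker to the vertex `y` (used only for vertices `y` of the tree). -/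
def moveTo (s : State) (y : ℕ) : State :=
  if hy : y ∈ s.tree.verts then { s with walker := y, walker_mem := hy } else s

open Classical in
/-- The possible positions after one step of the walker: the neighbours of its position, or the
position itself in the degenerate case of a tree with a single vertex. -/
def targets (s : State) : Set ℕ :=
  if (s.tree.neighborSet s.walker).Nonempty then s.tree.neighborSet s.walker else {s.walker}

lemma targets_finite (s : State) : s.targets.Finite := by
  unfold targets
  split_ifs
  · exact s.locallyFinite _
  · exact Set.finite_singleton _

lemma targets_nonempty (s : State) : s.targets.Nonempty := by
  unfold targets
  split_ifs with h
  · exact h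
  · exact Set.singleton_nonempty _

/-! Measurability of the coordinates of a state and of the maps above. -/

lemma measurable_code : Measurable code := comap_measurable _

lemma measurable_walker : Measurable walker :=
  measurable_snd.comp (measurable_snd.comp measurable_code)

lemma measurable_mem (v : ℕ) : Measurable fun s : State => v ∈ s.tree.verts :=
  (measurable_pi_apply v).comp (measurable_fst.comp measurable_code)

lemma measurable_adj (u v : ℕ) : Measurable fun s : State => s.tree.Adj u v :=
  (measurable_pi_apply v).comp ((measurable_pi_apply u).comp
    (measurable_fst.comp (measurable_snd.comp measurable_code)))

lemma measurable_of_coords {α : Type*} [MeasurableSpace α] {f : α → State}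
    (h1 : ∀ v, Measurable fun a => v ∈ (f a).tree.verts)
    (h2 : ∀ u v, Measurable fun a => (f a).tree.Adj u v)
    (h3 : Measurable fun a => (f a).walker) : Measurable f := by
  rw [measurable_comap_iff]
  exact (measurable_pi_lambda _ h1).prodMk
    ((measurable_pi_lambda _ fun u => measurable_pi_lambda _ (h2 u)).prodMk h3)

lemma measurable_newVertex : Measurable newVertex := by
  refine measurable_to_countable' fun k => ?_
  have : newVertex ⁻¹' {k} = {s : State | k ∉ s.tree.verts ∧ ∀ j, j < k → j ∈ s.tree.verts} := by
    ext s
    simp only [Set.mem_preimage, Set.mem_singleton_iff, Set.mem_ofPred_eq]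
    constructor
    · rintro rfl
      refine ⟨s.newVertex_notMem, fun j hj => ?_⟩
      by_contra h
      exact Nat.notMem_of_lt_sInf hj h
    · rintro ⟨h1, h2⟩
      refine le_antisymm (Nat.sInf_le h1) ?_
      by_contra h
      exact s.newVertex_notMem (h2 _ (not_le.1 h))
  rw [this]
  refine measurableSet_setOfPred.2 ((measurable_mem k).not.and ?_)
  exact Measurable.forall fun j => measurable_const.imp (measurable_mem j)

lemma measurable_eq_walker (u : ℕ) : Measurable fun s : State => u = s.walker :=
  measurableSet_setOfPred.1 (measurableSet_eq_fun measurable_const measurable_walker)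

lemma measurable_eq_newVertex (u : ℕ) : Measurable fun s : State => u = s.newVertex :=
  measurableSet_setOfPred.1 (measurableSet_eq_fun measurable_const measurable_newVertex)

lemma measurable_grow : Measurable grow := by
  refine measurable_of_coords (fun v => ?_) (fun u v => ?_) measurable_walker
  · simp only [grow, mem_verts_grownTree]
    exact (measurable_mem v).or (measurable_eq_newVertex v)
  · simp only [grow, adj_grownTree]
    exact (measurable_adj u v).or
      (((measurable_eq_walker u).and (measurable_eq_newVertex v)).or
        ((measurable_eq_newVertex u).and (measurable_eq_walker v)))

lemma tree_moveTo (s : State) (y : ℕ) : (s.moveTo y).tree = s.tree := by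
  unfold moveTo
  split_ifs <;> rfl

open Classical in
lemma walker_moveTo (s : State) (y : ℕ) :
    (s.moveTo y).walker = if y ∈ s.tree.verts then y else s.walker := by
  unfold moveTo
  split_ifs <;> rfl

lemma measurable_moveTo (y : ℕ) : Measurable fun s : State => s.moveTo y := by
  refine measurable_of_coords (fun v => ?_) (fun u v => ?_) ?_
  · simp only [tree_moveTo]
    exact measurable_mem v
  · simp only [tree_moveTo]
    exact measurable_adj u v
  · simp only [walker_moveTo]
    exact Measurable.ite (measurableSet_setOfPred.2 (measurable_mem y)) measurable_const
      measurable_walker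

lemma measurable_adj_walker (y : ℕ) : Measurable fun s : State => s.tree.Adj s.walker y := by
  have : (fun s : State => s.tree.Adj s.walker y) =
      fun s => ∃ x, x = s.walker ∧ s.tree.Adj x y := by
    ext s
    simp
  rw [this]
  exact Measurable.exists fun x => (measurable_eq_walker x).and (measurable_adj x y)

lemma measurableSet_mem_targets (y : ℕ) : MeasurableSet {s : State | y ∈ s.targets} := by
  have : (fun s : State => y ∈ s.targets) = fun s =>
      s.tree.Adj s.walker y ∨ ((∀ z, ¬ s.tree.Adj s.walker z) ∧ y = s.walker) := by
    ext s
    unfold targets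
    split_ifs with h
    · obtain ⟨z, hz⟩ := h
      simp only [Subgraph.mem_neighborSet] at hz ⊢
      constructor
      · exact Or.inl
      · rintro (h | h)
        · exact h
        · exact absurd hz (h.1 z)
    · rw [Set.not_nonempty_iff_eq_empty, Set.eq_empty_iff_forall_notMem] at h
      simp only [Subgraph.mem_neighborSet] at h
      simp [h]
  rw [measurableSet_setOfPred, this]
  exact (measurable_adj_walker y).or
    ((Measurable.forall fun z => (measurable_adj_walker z).not).and (measurable_eq_walker y))

lemma measurable_count {B : State → Set ℕ} (hB : ∀ y, MeasurableSet {s | y ∈ B s}) :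
    Measurable fun s => Measure.count (B s) := by
  have : (fun s => Measure.count (B s)) =
      fun s => ∑' y, {s | y ∈ B s}.indicator (fun _ => (1 : ℝ≥0∞)) s := by
    ext s
    rw [Measure.count, Measure.sum_apply _ (Set.to_countable _).measurableSet]
    refine tsum_congr fun y => ?_
    rw [Measure.dirac_apply' _ (Set.to_countable _).measurableSet]
    rfl
  rw [this]
  exact Measurable.tsum fun y => measurable_const.indicator (hB y)

end State

/-- First half of a step: with probability `p` a new leaf is attached to the walker's position,
and with probability `1 - p` nothing happens. -/
def growKernel (p : unitInterval) : Kernel State State where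
  toFun s := ENNReal.ofReal p • Measure.dirac s.grow + ENNReal.ofReal (1 - p) • Measure.dirac s
  measurable' := by
    refine Measure.measurable_of_measurable_coe _ fun A hA => ?_
    simp only [Measure.add_apply, Measure.smul_apply, smul_eq_mul]
    refine (Measurable.const_mul ?_ _).add (Measurable.const_mul ?_ _)
    · exact ((Measure.measurable_coe hA).comp Measure.measurable_dirac).comp State.measurable_grow
    · exact (Measure.measurable_coe hA).comp Measure.measurable_dirac

instance (p : unitInterval) : IsMarkovKernel (growKernel p) := by
  refine ⟨fun s => ⟨?_⟩⟩
  change (ENNReal.ofReal p • Measure.dirac s.grow +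
    ENNReal.ofReal (1 - p) • Measure.dirac s) Set.univ = 1
  simp only [Measure.add_apply, Measure.smul_apply, smul_eq_mul, measure_univ, mul_one]
  rw [← ENNReal.ofReal_add p.2.1 (sub_nonneg.2 p.2.2)]
  simp

/-- Second half of a step: the walker moves to a uniformly chosen neighbour of its position (and
stays put if the tree has a single vertex). -/
def jumpKernel : Kernel State State where
  toFun s := (uniformOn s.targets).map s.moveTo
  measurable' := by
    refine Measure.measurable_of_measurable_coe _ fun A hA => ?_
    have h : ∀ s : State, (uniformOn s.targets).map s.moveTo A =
        (Measure.count s.targets)⁻¹ * Measure.count (s.targets ∩ s.moveTo ⁻¹' A) := by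
      intro s
      rw [Measure.map_apply (measurable_of_countable _) hA, uniformOn,
        cond_apply (Set.to_countable _).measurableSet]
    simp only [h]
    refine (State.measurable_count State.measurableSet_mem_targets).inv.mul
      (State.measurable_count fun y => ?_)
    exact (State.measurableSet_mem_targets y).inter (State.measurable_moveTo y hA)

instance : IsMarkovKernel jumpKernel := by
  refine ⟨fun s => ?_⟩
  change IsProbabilityMeasure ((uniformOn s.targets).map s.moveTo)
  have := isProbabilityMeasure_uniformOn s.targets_finite s.targets_nonempty
  exact Measure.isProbabilityMeasure_map (measurable_of_countable _).aemeasurable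

/-- The transition kernel `K_p` of the Bernoulli growth random walk with parameter `p`: first the
tree may grow at the walker's position, then the walker takes one step on the current tree. -/
def stepKernel (p : unitInterval) : Kernel State State := jumpKernel ∘ₖ growKernel p

instance (p : unitInterval) : IsMarkovKernel (stepKernel p) := by
  unfold stepKernel
  infer_instance

/-- The law on trajectories `(T_n, X_n)_{n ≥ 0}` of the Bernoulli growth random walk with
parameter `p` started from the state `s`: the law of the Markov chain with transition kernel
`K_p` and initial law the point mass at `s`. -/
def law (p : unitInterval) (s : State) : Measure (ℕ → State) :=
  Kernel.trajMeasure (X := fun _ => State) (Measure.dirac s) fun n =>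
    (stepKernel p).comap (fun h => h ⟨n, Finset.mem_Iic.2 le_rfl⟩) (measurable_pi_apply _)

instance (p : unitInterval) (s : State) : IsProbabilityMeasure (law p s) := by
  unfold law
  infer_instance

end BGRW

end

/-! The level of the walker is its distance to the root. The core is a uniform escape estimate
(`UniformEscape`): from every state at level `j + 1`, the probability of ever reaching level `j` is
at most `1 - q`, with `q > 0` depending on `p` only.

Escape. Follow a vertex through its first `M` entries from its parent and let `1 - r` bound the
probability that all these visits end. At each of the first `b` entries a child is born with
probability `p` and recorded. Afterwards the recorded children compete with the parent for the moves
out of the vertex. Between one given child and the parent this duel is fair, so the child is entered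
`M` times before the remaining `M - b` returns to the parent with probability `fairRace M (M - b)`,
at least `1/4` for `M = 4 * b ^ 2 + b` (`fairRace_ge`). Each child entered `M` times costs a factor
`1 - r`. On average `p * b` children are recorded, so all `M` visits end with probability at most `1
- r / 2 * fairRace M (M - b) * p * b`, which is at most `1 - r` once `b ≥ 8 / p`: the bound
reproduces itself. Unrecorded neighbours do no harm, since an excursion there either returns or
never ends. To avoid circularity, the labels of the recorded vertices determine a number that bounds
the probability of reaching level `j` within `n` steps, and `visitBound_and_entryBound` proves this
by induction on `n`. One step of the chain averages these numbers correctly because they are affine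
in each label with nonnegative slope.

Speed. Escape gives `hitProb ≤ (1 - q) ^ (level - j)`, so `potential`, a weighted sum of hitting
probabilities, is comparable to `a ^ level`. One step decreases it by a fixed proportion, whence `a
^ level` has exponentially small expectation (`UniformEscape.exists_contraction`). Markov's
inequality and Borel–Cantelli finish the proof (`UniformEscape.exists_speed`). -/

namespace BGRW

/-! ### Distances in acyclic graphs. -/

section Graph

variable {V : Type*} {G H : SimpleGraph V}

/-- Geodesics from `r` to `u` and to `w` are too short to meet `v`. Extended by `v` they are two
paths from `r` to `v`, hence equal, and so are their penultimate vertices. This is the uniqueness of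
parents. -/
lemma eq_of_adj_of_dist_add_one (hG : G.IsAcyclic) {u v w r : V} (huv : G.Adj v u)
    (hwv : G.Adj v w) (hr : G.Reachable r v) (hu : G.dist r v = G.dist r u + 1)
    (hw : G.dist r v = G.dist r w + 1) : u = w := by
  obtain ⟨p, hp, hpl⟩ := (hr.trans huv.reachable).exists_path_of_dist
  obtain ⟨q, hq, hql⟩ := (hr.trans hwv.reachable).exists_path_of_dist
  have key : ∀ {x : V} (p : G.Walk r x), p.length + 1 = G.dist r v → v ∉ p.support := by
    classical
    intro x p hp hv
    have h1 := dist_le (p.takeUntil v hv)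
    have h2 := p.length_takeUntil_le_length hv
    omega
  have h1 := key p (by omega)
  have h2 := key q (by omega)
  have h3 := (hG.subsingleton_path r v).elim ⟨_, hp.concat h1 huv.symm⟩ ⟨_, hq.concat h2 hwv.symm⟩
  have h4 := congrArg (fun x : G.Path r v => x.1.penultimate) h3
  simpa using h4

lemma exists_adj_dist_add_one {r v : V} (hr : G.Reachable r v) (hne : r ≠ v) :
    ∃ u, G.Adj v u ∧ G.dist r v = G.dist r u + 1 := by
  obtain ⟨p, hp⟩ := hr.symm.exists_walk_length_eq_dist
  cases p with
  | nil => exact absurd rfl hne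
  | @cons _ u _ h q =>
    refine ⟨u, h, le_antisymm ?_ ?_⟩
    · have := h.symm.diff_dist_adj (u := r)
      omega
    · rw [Walk.length_cons, dist_comm] at hp
      have := dist_le q
      rw [dist_comm] at this
      omega

/-- A geodesic of `G` is a path of `H`, and paths of `H` are unique. Consequently growth of the tree
does not change levels. -/
lemma dist_eq_of_le_of_isAcyclic (hle : G ≤ H) (hH : H.IsAcyclic) {u v : V}
    (hr : G.Reachable u v) : H.dist u v = G.dist u v := by
  obtain ⟨p, hp, hpl⟩ := hr.exists_path_of_dist
  obtain ⟨q, hq, hql⟩ := (hr.mono hle).exists_path_of_dist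
  have h := (hH.subsingleton_path u v).elim ⟨_, hp.mapLe hle⟩ ⟨q, hq⟩
  have h2 := congrArg (fun x : H.Path u v => x.1.length) h
  simp only [Walk.length_map, Walk.mapLe] at h2
  omega

end Graph

/-! ### Levels, parents and measurability in the tree of a state. -/

namespace State

lemma isAcyclic (s : State) : s.tree.spanningCoe.IsAcyclic :=
  isAcyclic_spanningCoe _ s.isTree.2

lemma reachable (s : State) {u v : ℕ} (hu : u ∈ s.tree.verts) (hv : v ∈ s.tree.verts) :
    s.tree.spanningCoe.Reachable u v := by
  have h := s.isTree.1.preconnected ⟨u, hu⟩ ⟨v, hv⟩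
  exact h.map (⟨Subtype.val, fun h => h⟩ : s.tree.coe →g s.tree.spanningCoe)

lemma dist_of_adj (s : State) {u v root : ℕ} (hroot : root ∈ s.tree.verts) (h : s.tree.Adj u v) :
    s.dist u root = s.dist v root + 1 ∨ s.dist v root = s.dist u root + 1 := by
  have := s.isAcyclic.dist_eq_dist_add_one_of_adj_of_reachable root
    (show s.tree.spanningCoe.Adj u v from h) (s.reachable hroot (s.tree.edge_vert h))
  simpa only [State.dist, dist_comm] using this

lemma eq_of_adj_of_dist (s : State) {u v w root : ℕ} (hroot : root ∈ s.tree.verts)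
    (hu : s.tree.Adj v u) (hw : s.tree.Adj v w) (hu' : s.dist v root = s.dist u root + 1)
    (hw' : s.dist v root = s.dist w root + 1) : u = w := by
  simp only [State.dist, dist_comm (v := root)] at hu' hw'
  exact eq_of_adj_of_dist_add_one s.isAcyclic hu hw (s.reachable hroot (s.tree.edge_vert hu))
    hu' hw'

lemma exists_parent (s : State) {v root : ℕ} (hroot : root ∈ s.tree.verts)
    (hv : v ∈ s.tree.verts) (h0 : s.dist v root ≠ 0) :
    ∃ u, s.tree.Adj v u ∧ s.dist v root = s.dist u root + 1 := by
  have hne : root ≠ v := by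
    rintro rfl
    simp [State.dist] at h0
  obtain ⟨u, h1, h2⟩ := exists_adj_dist_add_one (s.reachable hroot hv) hne
  refine ⟨u, h1, ?_⟩
  simpa only [State.dist, dist_comm] using h2

lemma dist_grow (s : State) {v root : ℕ} (hroot : root ∈ s.tree.verts) (hv : v ∈ s.tree.verts) :
    s.grow.dist v root = s.dist v root := by
  refine dist_eq_of_le_of_isAcyclic ?_ s.grow.isAcyclic (s.reachable hv hroot)
  intro a b h
  exact (s.adj_grownTree a b).2 (Or.inl h)

lemma adj_grow (s : State) {u v : ℕ} : s.grow.tree.Adj u v ↔ s.tree.Adj u v ∨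
    (u = s.walker ∧ v = s.newVertex) ∨ (u = s.newVertex ∧ v = s.walker) :=
  s.adj_grownTree u v

lemma mem_verts_grow (s : State) {v : ℕ} :
    v ∈ s.grow.tree.verts ↔ v ∈ s.tree.verts ∨ v = s.newVertex :=
  s.mem_verts_grownTree v

@[simp] lemma walker_grow (s : State) : s.grow.walker = s.walker := rfl

/-- The walker's position is the only neighbour of the new vertex, so it must be its parent. -/
lemma dist_newVertex (s : State) {root : ℕ} (hroot : root ∈ s.tree.verts) :
    s.grow.dist s.newVertex root = s.dist s.walker root + 1 := by
  have hadj : s.grow.tree.Adj s.newVertex s.walker := s.adj_grow.2 (Or.inr (Or.inr ⟨rfl, rfl⟩))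
  have hroot' : root ∈ s.grow.tree.verts := s.mem_verts_grow.2 (Or.inl hroot)
  rcases s.grow.dist_of_adj hroot' hadj with h | h
  · rw [h, s.dist_grow hroot s.walker_mem]
  · exfalso
    have hne : s.grow.dist s.newVertex root ≠ 0 := by
      intro h0
      have := (s.grow.reachable (s.mem_verts_grow.2 (Or.inr rfl)) hroot').dist_eq_zero_iff.1 h0
      exact s.newVertex_notMem (this ▸ hroot)
    obtain ⟨u, hu, hu'⟩ := s.grow.exists_parent hroot' (s.mem_verts_grow.2 (Or.inr rfl)) hne
    rcases s.adj_grow.1 hu with h1 | h1 | h1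
    · exact s.newVertex_notMem (s.tree.edge_vert h1)
    · exact s.newVertex_notMem (h1.1 ▸ s.walker_mem)
    · rw [h1.2] at hu'
      omega

@[simp] lemma dist_moveTo (s : State) (y u v : ℕ) : (s.moveTo y).dist u v = s.dist u v := by
  simp only [State.dist, tree_moveTo]

lemma mem_targets_iff_of_adj (s : State) {z : ℕ} (hz : s.tree.Adj s.walker z) {y : ℕ} :
    y ∈ s.targets ↔ s.tree.Adj s.walker y := by
  unfold targets
  rw [if_pos ⟨z, hz⟩]
  rfl

lemma targets_subset_verts (s : State) {y : ℕ} (hy : y ∈ s.targets) : y ∈ s.tree.verts := by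
  unfold targets at hy
  split_ifs at hy
  · exact s.tree.edge_vert (Subgraph.Adj.symm hy)
  · rw [Set.mem_singleton_iff] at hy
    exact hy ▸ s.walker_mem

lemma walker_moveTo_of_mem (s : State) {y : ℕ} (hy : y ∈ s.targets) :
    (s.moveTo y).walker = y := by
  rw [walker_moveTo, if_pos (s.targets_subset_verts hy)]

lemma adj_or_eq_of_mem_targets (s : State) {y : ℕ} (hy : y ∈ s.targets) :
    s.tree.Adj s.walker y ∨ y = s.walker := by
  unfold targets at hy
  split_ifs at hy
  · exact Or.inl hy
  · exact Or.inr hy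

/-- The level of the walker: its distance to the root. -/
noncomputable def level (root : ℕ) (s : State) : ℕ := s.dist s.walker root

@[simp] lemma level_grow (s : State) {root : ℕ} (hroot : root ∈ s.tree.verts) :
    level root s.grow = level root s := s.dist_grow hroot s.walker_mem

/-! Measurability of the graph distance. -/

lemma measurable_exists_walk (n : ℕ) (u v : ℕ) :
    Measurable fun s : State => ∃ p : s.tree.spanningCoe.Walk u v, p.length = n := by
  induction n generalizing u with
  | zero =>
    have : (fun s : State => ∃ p : s.tree.spanningCoe.Walk u v, p.length = 0) =
        fun _ => u = v := by
      ext s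
      constructor
      · rintro ⟨p, hp⟩
        exact Walk.eq_of_length_eq_zero hp
      · rintro rfl
        exact ⟨Walk.nil, rfl⟩
    rw [this]
    exact measurable_const
  | succ n ih =>
    have : (fun s : State => ∃ p : s.tree.spanningCoe.Walk u v, p.length = n + 1) =
        fun s => ∃ w, s.tree.Adj u w ∧ ∃ p : s.tree.spanningCoe.Walk w v, p.length = n := by
      ext s
      constructor
      · rintro ⟨p, hp⟩
        cases p with
        | nil => simp at hp
        | cons h q => exact ⟨_, h, q, by simpa using hp⟩
      · rintro ⟨w, h, q, hq⟩
        exact ⟨Walk.cons (show s.tree.spanningCoe.Adj u w from h) q, by rw [Walk.length_cons, hq]⟩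
    rw [this]
    exact Measurable.exists fun w => (measurable_adj u w).and (ih w)

lemma measurable_dist (u v : ℕ) : Measurable fun s : State => s.dist u v := by
  refine measurable_to_countable' fun k => ?_
  -- The second alternative covers unreachable vertices, whose distance is `0` by convention.
  have : (fun s : State => s.dist u v) ⁻¹' {k} = {s : State |
      ((∃ p : s.tree.spanningCoe.Walk u v, p.length = k) ∧
        ∀ j, j < k → ¬ ∃ p : s.tree.spanningCoe.Walk u v, p.length = j) ∨
      (k = 0 ∧ ∀ j, ¬ ∃ p : s.tree.spanningCoe.Walk u v, p.length = j)} := by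
    ext s
    simp only [Set.mem_preimage, Set.mem_singleton_iff, Set.mem_ofPred_eq]
    constructor
    · intro h
      by_cases hr : s.tree.spanningCoe.Reachable u v
      · left
        subst h
        refine ⟨hr.exists_walk_length_eq_dist, ?_⟩
        rintro j hj ⟨p, hp⟩
        have := dist_le p
        unfold State.dist at hj
        omega
      · right
        refine ⟨?_, fun j ⟨p, _⟩ => hr ⟨p⟩⟩
        rw [← h]
        exact dist_eq_zero_of_not_reachable hr
    · rintro (⟨⟨p, hp⟩, h⟩ | ⟨h0, h⟩)
      · have h1 := dist_le p
        obtain ⟨q, hq⟩ := Reachable.exists_walk_length_eq_dist ⟨p⟩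
        by_contra hne
        refine h (s.dist u v) ?_ ⟨q, hq⟩
        unfold State.dist at hne ⊢
        omega
      · rw [h0]
        exact dist_eq_zero_of_not_reachable fun ⟨p⟩ => h _ ⟨p, rfl⟩
  rw [this, measurableSet_setOfPred]
  refine ((measurable_exists_walk k u v).and ?_).or (measurable_const.and ?_)
  · exact Measurable.forall fun j => measurable_const.imp (measurable_exists_walk j u v).not
  · exact Measurable.forall fun j => (measurable_exists_walk j u v).not

lemma measurable_level (root : ℕ) : Measurable (level root) := by
  refine measurable_to_countable' fun k => ?_
  have : level root ⁻¹' {k} = {s : State | ∃ x, x = s.walker ∧ s.dist x root = k} := by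
    ext s
    simp [level]
  rw [this, measurableSet_setOfPred]
  refine Measurable.exists fun x => (measurable_eq_walker x).and ?_
  exact measurableSet_setOfPred.1 (measurable_dist x root (measurableSet_singleton k))

/-- The targets as a finite set. -/
noncomputable def targetsFinset (s : State) : Finset ℕ := s.targets_finite.toFinset

@[simp] lemma mem_targetsFinset (s : State) {y : ℕ} : y ∈ s.targetsFinset ↔ y ∈ s.targets := by
  simp [targetsFinset]

lemma targetsFinset_nonempty (s : State) : s.targetsFinset.Nonempty := by
  obtain ⟨y, hy⟩ := s.targets_nonempty
  exact ⟨y, s.mem_targetsFinset.2 hy⟩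

end State

open State

/-! Integrals with respect to the transition kernel. -/

lemma lintegral_jumpKernel (s : State) {f : State → ℝ≥0∞} (hf : Measurable f) :
    ∫⁻ s', f s' ∂(jumpKernel s) =
      (s.targetsFinset.card : ℝ≥0∞)⁻¹ * ∑ y ∈ s.targetsFinset, f (s.moveTo y) := by
  change ∫⁻ s', f s' ∂((uniformOn s.targets).map s.moveTo) = _
  rw [lintegral_map hf (measurable_of_countable _), uniformOn, ProbabilityTheory.cond,
    lintegral_smul_measure]
  have h : s.targets = (s.targetsFinset : Set ℕ) := by simp [targetsFinset]
  rw [h, Measure.count_apply_finset, lintegral_finset]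
  simp

lemma lintegral_growKernel (p : unitInterval) (s : State) {f : State → ℝ≥0∞} (hf : Measurable f) :
    ∫⁻ s', f s' ∂(growKernel p s) =
      ENNReal.ofReal p * f s.grow + ENNReal.ofReal (1 - p) * f s := by
  change ∫⁻ s', f s' ∂(ENNReal.ofReal p • Measure.dirac s.grow +
    ENNReal.ofReal (1 - p) • Measure.dirac s) = _
  rw [lintegral_add_measure, lintegral_smul_measure, lintegral_smul_measure,
    lintegral_dirac' _ hf, lintegral_dirac' _ hf]
  rfl

lemma lintegral_stepKernel (p : unitInterval) (s : State) {f : State → ℝ≥0∞} (hf : Measurable f) :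
    ∫⁻ s', f s' ∂(stepKernel p s) =
      ENNReal.ofReal p * ∫⁻ s', f s' ∂(jumpKernel s.grow) +
        ENNReal.ofReal (1 - p) * ∫⁻ s', f s' ∂(jumpKernel s) := by
  rw [stepKernel, Kernel.lintegral_comp _ _ _ hf, lintegral_growKernel p s hf.lintegral_kernel]

lemma lintegral_jumpKernel_mono (s : State) {f g : State → ℝ≥0∞} (hf : Measurable f)
    (hg : Measurable g) (h : ∀ y ∈ s.targets, f (s.moveTo y) ≤ g (s.moveTo y)) :
    ∫⁻ s', f s' ∂(jumpKernel s) ≤ ∫⁻ s', g s' ∂(jumpKernel s) := by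
  rw [lintegral_jumpKernel s hf, lintegral_jumpKernel s hg]
  gcongr with y hy
  exact h y (s.mem_targetsFinset.1 hy)

lemma lintegral_stepKernel_mono (p : unitInterval) (s : State) {f g : State → ℝ≥0∞}
    (hf : Measurable f) (hg : Measurable g)
    (h1 : ∀ y ∈ s.grow.targets, f (s.grow.moveTo y) ≤ g (s.grow.moveTo y))
    (h2 : ∀ y ∈ s.targets, f (s.moveTo y) ≤ g (s.moveTo y)) :
    ∫⁻ s', f s' ∂(stepKernel p s) ≤ ∫⁻ s', g s' ∂(stepKernel p s) := by
  rw [lintegral_stepKernel p s hf, lintegral_stepKernel p s hg]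
  exact add_le_add (mul_le_mul_right (lintegral_jumpKernel_mono _ hf hg h1) _)
    (mul_le_mul_right (lintegral_jumpKernel_mono _ hf hg h2) _)

lemma lintegral_jumpKernel_le (s : State) {f : State → ℝ≥0∞} (hf : Measurable f) {A : ℕ → ℝ}
    {U : ℝ} (h : ∀ y ∈ s.targets, f (s.moveTo y) ≤ ENNReal.ofReal (A y))
    (h0 : ∀ y ∈ s.targets, 0 ≤ A y)
    (hU : ∑ y ∈ s.targetsFinset, A y ≤ s.targetsFinset.card * U) :
    ∫⁻ s', f s' ∂(jumpKernel s) ≤ ENNReal.ofReal U := by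
  have hc : (0 : ℝ) < s.targetsFinset.card := by exact_mod_cast s.targetsFinset_nonempty.card_pos
  rw [lintegral_jumpKernel s hf]
  calc (s.targetsFinset.card : ℝ≥0∞)⁻¹ * ∑ y ∈ s.targetsFinset, f (s.moveTo y)
      ≤ (s.targetsFinset.card : ℝ≥0∞)⁻¹ * ∑ y ∈ s.targetsFinset, ENNReal.ofReal (A y) := by
        gcongr with y hy
        exact h y (s.mem_targetsFinset.1 hy)
    _ = ENNReal.ofReal ((s.targetsFinset.card : ℝ)⁻¹ * ∑ y ∈ s.targetsFinset, A y) := by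
        rw [ENNReal.ofReal_mul (by positivity), ENNReal.ofReal_inv_of_pos hc,
          ENNReal.ofReal_natCast, ENNReal.ofReal_sum_of_nonneg]
        exact fun y hy => h0 y (s.mem_targetsFinset.1 hy)
    _ ≤ ENNReal.ofReal U := by
        apply ENNReal.ofReal_le_ofReal
        rw [inv_mul_le_iff₀ hc]
        exact hU

lemma lintegral_stepKernel_le (p : unitInterval) (s : State) {f : State → ℝ≥0∞} {U U1 U2 : ℝ}
    (hf : Measurable f) (h1 : ∫⁻ s', f s' ∂(jumpKernel s.grow) ≤ ENNReal.ofReal U1)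
    (h2 : ∫⁻ s', f s' ∂(jumpKernel s) ≤ ENNReal.ofReal U2) (hU1 : 0 ≤ U1) (hU2 : 0 ≤ U2)
    (hU : p * U1 + (1 - p) * U2 ≤ U) :
    ∫⁻ s', f s' ∂(stepKernel p s) ≤ ENNReal.ofReal U := by
  have hp := p.2.1
  have hp' : 0 ≤ 1 - (p : ℝ) := sub_nonneg.2 p.2.2
  rw [lintegral_stepKernel p s hf]
  calc _ ≤ ENNReal.ofReal p * ENNReal.ofReal U1 + ENNReal.ofReal (1 - p) * ENNReal.ofReal U2 := by
        gcongr
    _ = ENNReal.ofReal (p * U1 + (1 - p) * U2) := by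
        rw [ENNReal.ofReal_add (by positivity) (by positivity), ENNReal.ofReal_mul hp,
          ENNReal.ofReal_mul hp']
    _ ≤ _ := ENNReal.ofReal_le_ofReal hU

/-- The probability that the chain reaches a level at most `j` within `n` steps. -/
noncomputable def hitProb (p : unitInterval) (root j : ℕ) : ℕ → State → ℝ≥0∞
  | 0, s => if level root s ≤ j then 1 else 0
  | n + 1, s => if level root s ≤ j then 1 else ∫⁻ s', hitProb p root j n s' ∂(stepKernel p s)

lemma measurable_hitProb (p : unitInterval) (root j n : ℕ) :
    Measurable (hitProb p root j n) := by
  have hm : MeasurableSet {s | level root s ≤ j} := measurable_level root measurableSet_Iic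
  induction n with
  | zero => exact Measurable.ite hm measurable_const measurable_const
  | succ n ih => exact Measurable.ite hm measurable_const ih.lintegral_kernel

variable {p : unitInterval} {root j n : ℕ} {s : State}

lemma hitProb_of_level_le (h : level root s ≤ j) : hitProb p root j n s = 1 := by
  cases n <;> simp [hitProb, h]

lemma hitProb_succ_of_lt (h : j < level root s) :
    hitProb p root j (n + 1) s = ∫⁻ s', hitProb p root j n s' ∂(stepKernel p s) := by
  simp [hitProb, not_le.2 h]

lemma hitProb_le_one : hitProb p root j n s ≤ 1 := by
  induction n generalizing s with
  | zero => unfold hitProb; split_ifs <;> simp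
  | succ n ih =>
    unfold hitProb
    split_ifs
    · exact le_rfl
    · calc _ ≤ ∫⁻ _, 1 ∂(stepKernel p s) := lintegral_mono fun s' => ih
        _ = 1 := by simp

lemma level_moveTo_of_mem (hroot : root ∈ s.tree.verts) {y : ℕ} (hy : y ∈ s.targets) :
    level root (s.moveTo y) = level root s + 1 ∨ level root s = level root (s.moveTo y) + 1 ∨
      level root (s.moveTo y) = level root s := by
  unfold level
  rw [s.walker_moveTo_of_mem hy, dist_moveTo]
  rcases s.adj_or_eq_of_mem_targets hy with h | h
  · have := s.dist_of_adj hroot h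
    tauto
  · simp [h]

end BGRW

/-! ### Drift argument: uniform escape implies positive speed. -/

namespace BGRW

open State

variable {p : unitInterval} {root j n : ℕ} {s : State}

/-! Marginals of the chain. -/

/-- The transition operator acting on nonnegative functions. -/
noncomputable def transition (p : unitInterval) (g : State → ℝ≥0∞) (s : State) : ℝ≥0∞ :=
  ∫⁻ s', g s' ∂(stepKernel p s)

lemma measurable_transition {g : State → ℝ≥0∞} (hg : Measurable g) :
    Measurable (transition p g) :=
  hg.lintegral_kernel

lemma lintegral_law_zero {g : State → ℝ≥0∞} (hg : Measurable g) :
    ∫⁻ ω, g (ω 0) ∂(law p s) = g s := by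
  have hmap : (law p s).map (Preorder.frestrictLe 0) =
      (Measure.dirac s).map (MeasurableEquiv.piUnique fun _ : Finset.Iic 0 => State).symm := by
    rw [law, Kernel.trajMeasure, Measure.map_comp _ _ (by fun_prop), Kernel.traj_map_frestrictLe,
      Kernel.partialTraj_self, Measure.id_comp]
  have h0 : Measurable fun h : (i : Finset.Iic 0) → State => g (h ⟨0, by simp⟩) :=
    hg.comp (measurable_pi_apply _)
  have h1 : ∫⁻ ω, g (ω 0) ∂(law p s) =
      ∫⁻ h, g (h ⟨0, by simp⟩) ∂((law p s).map (Preorder.frestrictLe 0)) := by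
    rw [lintegral_map h0 (by fun_prop)]
    rfl
  rw [h1, hmap, lintegral_map h0 (by fun_prop)]
  refine lintegral_dirac' _ ?_
  exact h0.comp (MeasurableEquiv.measurable _)

/-- The Markov property at time `n`: the joint law of the trajectory up to `n` and of the next state
is a composition product with the kernel. -/
lemma lintegral_law_succ {g : State → ℝ≥0∞} (hg : Measurable g) (n : ℕ) :
    ∫⁻ ω, g (ω (n + 1)) ∂(law p s) = ∫⁻ ω, transition p g (ω n) ∂(law p s) := by
  have h := Kernel.map_frestrictLe_trajMeasure_compProd_eq_map_trajMeasure (X := fun _ => State)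
    (μ₀ := Measure.dirac s) (κ := fun n => (stepKernel p).comap
      (fun h => h ⟨n, Finset.mem_Iic.2 le_rfl⟩) (measurable_pi_apply _)) (a := n)
  change (law p s).map _ ⊗ₘ _ = (law p s).map _ at h
  have h0 : Measurable fun x : ((i : Finset.Iic n) → State) × State => g x.2 :=
    hg.comp measurable_snd
  have h1 : ∫⁻ ω, g (ω (n + 1)) ∂(law p s) = ∫⁻ x, g x.2 ∂((law p s).map
      (fun x => (Preorder.frestrictLe (π := fun _ => State) n x, x (n + 1)))) := by
    rw [lintegral_map h0 (by fun_prop)]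
  rw [h1, ← h, Measure.lintegral_compProd h0, lintegral_map _ (by fun_prop)]
  · rfl
  · exact (measurable_transition hg).comp (measurable_pi_apply _)

lemma lintegral_law {g : State → ℝ≥0∞} (hg : Measurable g) (n : ℕ) :
    ∫⁻ ω, g (ω n) ∂(law p s) = (transition p)^[n] g s := by
  induction n generalizing g with
  | zero => exact lintegral_law_zero hg
  | succ n ih =>
    rw [lintegral_law_succ hg, ih (measurable_transition hg), Function.iterate_succ_apply]

/-! From uniform escape to geometric decay. -/

lemma root_mem_grow (hroot : root ∈ s.tree.verts) : root ∈ s.grow.tree.verts :=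
  s.mem_verts_grow.2 (Or.inl hroot)

lemma root_mem_moveTo (hroot : root ∈ s.tree.verts) (y : ℕ) : root ∈ (s.moveTo y).tree.verts := by
  rwa [tree_moveTo]

/-- The states reachable in one step still contain the root and are at most one level lower, so the
comparison is needed only there. -/
lemma lintegral_stepKernel_mono_of_root {f g : State → ℝ≥0∞} (hf : Measurable f)
    (hg : Measurable g) (hroot : root ∈ s.tree.verts)
    (h : ∀ s', root ∈ s'.tree.verts → level root s ≤ level root s' + 1 → f s' ≤ g s') :
    ∫⁻ s', f s' ∂(stepKernel p s) ≤ ∫⁻ s', g s' ∂(stepKernel p s) := by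
  refine lintegral_stepKernel_mono p s hf hg (fun y hy => ?_) (fun y hy => ?_)
  · refine h _ (root_mem_moveTo (root_mem_grow hroot) y) ?_
    have := level_moveTo_of_mem (root_mem_grow hroot) hy
    rw [level_grow s hroot] at this
    omega
  · refine h _ (root_mem_moveTo hroot y) ?_
    have := level_moveTo_of_mem hroot hy
    omega

/-- Strong Markov property at the passage through level `l`, which cannot be skipped because a step
lowers the level by at most one. Induction on the horizon replaces stopping times. -/
lemma hitProb_le_mul {β : ℝ≥0∞} {l : ℕ} (hjl : j ≤ l)
    (h : ∀ n s, root ∈ s.tree.verts → level root s = l → hitProb p root j n s ≤ β)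
    (hroot : root ∈ s.tree.verts) (hl : l ≤ level root s) :
    hitProb p root j n s ≤ β * hitProb p root l n s := by
  induction n generalizing s with
  | zero =>
    rcases hl.eq_or_lt with hl | hl
    · rw [hitProb_of_level_le hl.ge, mul_one]
      exact h _ s hroot hl.symm
    · simp [hitProb, not_le.2 (hjl.trans_lt hl)]
  | succ n ih =>
    rcases hl.eq_or_lt with hl | hl
    · rw [hitProb_of_level_le hl.ge, mul_one]
      exact h _ s hroot hl.symm
    · rw [hitProb_succ_of_lt hl, hitProb_succ_of_lt (hjl.trans_lt hl),
        ← lintegral_const_mul _ (measurable_hitProb ..)]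
      refine lintegral_stepKernel_mono_of_root (measurable_hitProb ..)
        ((measurable_hitProb ..).const_mul _) hroot fun s' hr hs' => ih hr ?_
      omega

/-- The probability of ever going down one level is bounded away from one. -/
def UniformEscape (p : unitInterval) (q : ℝ) : Prop :=
  ∀ (root j n : ℕ) (s : State), root ∈ s.tree.verts → level root s = j + 1 →
    hitProb p root j n s ≤ ENNReal.ofReal (1 - q)

lemma UniformEscape.hitProb_le {q : ℝ} (h : UniformEscape p q) (hroot : root ∈ s.tree.verts)
    (n : ℕ) : hitProb p root j n s ≤ ENNReal.ofReal (1 - q) ^ (level root s - j) := by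
  obtain ⟨k, hk⟩ : ∃ k, level root s - j = k := ⟨_, rfl⟩
  rw [hk]
  induction k generalizing s n with
  | zero => simpa using hitProb_le_one
  | succ k ih =>
    rw [pow_succ]
    refine (hitProb_le_mul (l := j + k) (by omega) (fun n s hr hs => ih hr n ?_) hroot
      (by omega)).trans ?_
    · omega
    · gcongr
      exact h root (j + k) n s hroot (by omega)

/-- After a growth, which has probability `p`, the new leaf is one level up and at most one
neighbour, the parent, is not. The walker then goes up with probability at least `1/2`. -/
lemma lintegral_stepKernel_le_of_up {f : State → ℝ≥0∞} (hf : Measurable f) (hf1 : ∀ s, f s ≤ 1)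
    {q : ℝ} (hq : 0 ≤ q) (hq1 : q ≤ 1) (hroot : root ∈ s.tree.verts)
    (h : ∀ y, s.grow.tree.Adj s.walker y → s.grow.dist y root = level root s + 1 →
      f (s.grow.moveTo y) ≤ ENNReal.ofReal (1 - q)) :
    ∫⁻ s', f s' ∂(stepKernel p s) ≤ ENNReal.ofReal (1 - p * q / 2) := by
  classical
  have hadj : s.grow.tree.Adj s.walker s.newVertex := s.adj_grow.2 (Or.inr (Or.inl ⟨rfl, rfl⟩))
  have hadj' : s.grow.tree.Adj s.grow.walker s.newVertex := hadj
  refine lintegral_stepKernel_le p s (U1 := 1 - q / 2) (U2 := 1) hf ?_ ?_ (by linarith)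
    zero_le_one (by linarith)
  · set up := s.grow.targetsFinset.filter fun y => s.grow.dist y root = level root s + 1 with hup
    refine lintegral_jumpKernel_le s.grow hf
      (A := fun y => 1 - if s.grow.dist y root = level root s + 1 then q else 0) ?_ ?_ ?_
    · intro y hy
      split_ifs with hy'
      · exact h y ((s.grow.mem_targets_iff_of_adj hadj').1 hy) hy'
      · simpa using hf1 _
    · intro y _
      split_ifs <;> linarith
    · rw [Finset.sum_sub_distrib, ← Finset.sum_filter, ← hup]
      simp only [Finset.sum_const, nsmul_eq_mul, mul_one]
      have h1 : s.newVertex ∈ up := by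
        rw [hup, Finset.mem_filter, mem_targetsFinset, s.grow.mem_targets_iff_of_adj hadj']
        exact ⟨hadj, s.dist_newVertex hroot⟩
      have h2 : (s.grow.targetsFinset \ up).card ≤ 1 := by
        rw [Finset.card_le_one]
        have key : ∀ y ∈ s.grow.targetsFinset \ up, s.grow.tree.Adj s.walker y ∧
            s.grow.dist s.walker root = s.grow.dist y root + 1 := by
          intro y hy
          rw [Finset.mem_sdiff, hup, Finset.mem_filter, mem_targetsFinset,
            s.grow.mem_targets_iff_of_adj hadj'] at hy
          refine ⟨hy.1, ?_⟩
          have h3 := s.grow.dist_of_adj (root_mem_grow hroot) hy.1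
          have h4 : s.grow.dist s.grow.walker root = level root s := level_grow s hroot
          rw [h4] at h3
          change s.grow.dist s.grow.walker root = _
          rw [h4]
          exact h3.resolve_right fun h5 => hy.2 ⟨hy.1, h5⟩
        intro x hx y hy
        exact s.grow.eq_of_adj_of_dist (root_mem_grow hroot) (key x hx).1 (key y hy).1
          (key x hx).2 (key y hy).2
      have h3 : (s.grow.targetsFinset \ up).card + up.card = s.grow.targetsFinset.card :=
        Finset.card_sdiff_add_card_eq_card (Finset.filter_subset _ _)
      have h4 : 1 ≤ up.card := Finset.card_pos.2 ⟨_, h1⟩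
      have h5 : (s.grow.targetsFinset.card : ℝ) ≤ 2 * up.card := by
        exact_mod_cast (by omega : s.grow.targetsFinset.card ≤ 2 * up.card)
      nlinarith
  · rw [ENNReal.ofReal_one]
    calc _ ≤ ∫⁻ _, 1 ∂(jumpKernel s) := lintegral_mono fun s' => hf1 s'
      _ = 1 := by simp

/-- The Lyapunov function. -/
noncomputable def potential (p : unitInterval) (root : ℕ) (a : ℝ≥0∞) (n : ℕ) (s : State) : ℝ≥0∞ :=
  ∑' j, a ^ j * hitProb p root j n s

lemma measurable_potential (a : ℝ≥0∞) : Measurable (potential p root a n) :=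
  Measurable.tsum fun j => (measurable_hitProb p root j n).const_mul _

lemma tsum_pow_absdiff_le (a : ℝ≥0∞) (l : ℕ) :
    ∑' j : ℕ, a ^ ((l - j) + (j - l)) ≤ 2 * (1 - a)⁻¹ := by
  rw [← Summable.sum_add_tsum_nat_add' (k := l) ENNReal.summable, two_mul]
  refine add_le_add ?_ ?_
  · rw [← ENNReal.tsum_geometric, ← Finset.sum_range_reflect]
    calc ∑ i ∈ Finset.range l, a ^ ((l - (l - 1 - i)) + (l - 1 - i - l))
        ≤ ∑ i ∈ Finset.range l, a ^ (i + 1) := by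
          refine Finset.sum_le_sum fun i hi => ?_
          rw [Finset.mem_range] at hi
          rw [show l - (l - 1 - i) + (l - 1 - i - l) = i + 1 by omega]
      _ = ∑ i ∈ (Finset.range l).map ⟨(· + 1), add_left_injective 1⟩, a ^ i := by simp
      _ ≤ _ := ENNReal.sum_le_tsum _
  · rw [← ENNReal.tsum_geometric]
    exact ENNReal.tsum_le_tsum fun i => by rw [show l - (i + l) + (i + l - l) = i by omega]

/-- With `1 - q ≤ a ^ 2`, the term of index `j` is at most `a ^ level` times `a` to the power
`|level - j|`. That distance is written as a sum of two truncated differences. -/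
lemma UniformEscape.potential_le {q : ℝ} (h : UniformEscape p q) (hroot : root ∈ s.tree.verts)
    {a : ℝ≥0∞} (ha : ENNReal.ofReal (1 - q) ≤ a ^ 2) :
    potential p root a n s ≤ 2 * (1 - a)⁻¹ * a ^ level root s := by
  calc potential p root a n s
      ≤ ∑' j, a ^ level root s * a ^ ((level root s - j) + (j - level root s)) := by
        refine ENNReal.tsum_le_tsum fun j => ?_
        calc _ ≤ a ^ j * (a ^ 2) ^ (level root s - j) := by
              gcongr
              exact (h.hitProb_le hroot n).trans (by gcongr)
          _ = _ := by
              rw [← pow_mul, ← pow_add, ← pow_add]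
              congr 1
              omega
    _ ≤ _ := by
        rw [ENNReal.tsum_mul_left, mul_comm]
        gcongr
        exact tsum_pow_absdiff_le a _

/-- The terms with `j` different from the current level cannot increase. The term at the current
level, where the hitting probability is `1`, loses `p * q / 2` because the walker may go up and
escape. -/
lemma UniformEscape.transition_potential_add_le {q : ℝ} (h : UniformEscape p q) (hq : 0 ≤ q)
    (hq1 : q ≤ 1) (hroot : root ∈ s.tree.verts) (a : ℝ≥0∞) :
    transition p (potential p root a n) s + ENNReal.ofReal (p * q / 2) * a ^ level root s ≤
      potential p root a (n + 1) s := by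
  have hp := p.2.1
  have hp1 := p.2.2
  have h1 : transition p (potential p root a n) s =
      ∑' j, a ^ j * ∫⁻ s', hitProb p root j n s' ∂(stepKernel p s) := by
    unfold transition potential
    rw [lintegral_tsum fun j => ((measurable_hitProb p root j n).const_mul _).aemeasurable]
    exact tsum_congr fun j => lintegral_const_mul _ (measurable_hitProb p root j n)
  have h2 : ENNReal.ofReal (p * q / 2) * a ^ level root s = ∑' j, if j = level root s then
      a ^ j * ENNReal.ofReal (p * q / 2) else 0 := by
    rw [tsum_ite_eq, mul_comm]
  rw [h1, h2, ← ENNReal.tsum_add]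
  refine ENNReal.tsum_le_tsum fun j => ?_
  split_ifs with hj
  · rw [← mul_add, hitProb_of_level_le hj.ge]
    gcongr
    have h3 : ∫⁻ s', hitProb p root j n s' ∂(stepKernel p s) ≤
        ENNReal.ofReal (1 - p * q / 2) := by
      refine lintegral_stepKernel_le_of_up (measurable_hitProb ..) (fun _ => hitProb_le_one) hq hq1
        hroot fun y hy hy' => ?_
      have hy1 : y ∈ s.grow.targets := (s.grow.mem_targets_iff_of_adj (z := y) hy).2 hy
      refine h root j n _ (root_mem_moveTo (root_mem_grow hroot) y) ?_
      unfold level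
      rw [s.grow.walker_moveTo_of_mem hy1, dist_moveTo, hy', hj]
    calc _ ≤ ENNReal.ofReal (1 - p * q / 2) + ENNReal.ofReal (p * q / 2) := by gcongr
      _ = 1 := by
        rw [← ENNReal.ofReal_add (by nlinarith) (by positivity)]
        simp
  · rw [add_zero]
    gcongr
    rcases le_or_gt (level root s) j with hl | hl
    · rw [hitProb_of_level_le hl]
      calc _ ≤ ∫⁻ _, 1 ∂(stepKernel p s) := lintegral_mono fun s' => hitProb_le_one
        _ = 1 := by simp
    · rw [hitProb_succ_of_lt hl]

lemma UniformEscape.exists_contraction {q : ℝ} (h : UniformEscape p q) (hp : 0 < p) (hq : 0 < q)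
    (hq1 : q ≤ 1) : ∃ a lam C : ℝ, 0 < a ∧ a < 1 ∧ 0 < lam ∧ lam < 1 ∧ 0 ≤ C ∧
      ∀ (root n : ℕ) (s : State), root ∈ s.tree.verts →
        ∫⁻ ω, ENNReal.ofReal (a ^ level root (ω n)) ∂(law p s) ≤ ENNReal.ofReal (C * lam ^ n) := by
  have hp0 : (0 : ℝ) < p := hp
  have hp1 : (p : ℝ) ≤ 1 := p.2.2
  -- This choice gives `1 - q ≤ a ^ 2`.
  set a : ℝ := 1 - q / 2 with ha
  have ha0 : 0 < a := by linarith
  have ha1 : a < 1 := by linarith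
  set C : ℝ := 2 * (1 - a)⁻¹ with hC
  have hC0 : 0 < C := mul_pos two_pos (inv_pos.2 (by linarith))
  have hC2 : 2 ≤ C := by
    have : 1 ≤ (1 - a)⁻¹ := (one_le_inv₀ (by linarith)).2 (by linarith)
    linarith
  -- The loss `p * q / 2 * a ^ level` is at least `δ` times the potential, which is at most `C * a ^
  -- level`.
  set δ : ℝ := p * q / 2 / C with hδ
  have hδ0 : 0 < δ := by positivity
  have hδ1 : δ < 1 := by
    rw [hδ, div_lt_one hC0]
    nlinarith
  have hCe : ENNReal.ofReal C = 2 * (1 - ENNReal.ofReal a)⁻¹ := by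
    rw [hC, ENNReal.ofReal_mul (by norm_num), ENNReal.ofReal_inv_of_pos (by linarith),
      ENNReal.ofReal_sub _ ha0.le]
    simp
  have hbound : ∀ (root n : ℕ) (s : State), root ∈ s.tree.verts →
      potential p root (ENNReal.ofReal a) n s ≤
        ENNReal.ofReal C * ENNReal.ofReal a ^ level root s := by
    intro root n s hroot
    rw [hCe]
    refine h.potential_le hroot ?_
    rw [← ENNReal.ofReal_pow ha0.le]
    exact ENNReal.ofReal_le_ofReal (by nlinarith)
  have hfin : ∀ (root n : ℕ) (s : State), root ∈ s.tree.verts →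
      potential p root (ENNReal.ofReal a) n s ≠ ⊤ := fun root n s hroot =>
    ((hbound root n s hroot).trans_lt (ENNReal.mul_lt_top ENNReal.ofReal_lt_top
      (ENNReal.pow_lt_top ENNReal.ofReal_lt_top))).ne
  have hstep : ∀ (root n : ℕ) (s : State), root ∈ s.tree.verts →
      transition p (potential p root (ENNReal.ofReal a) n) s ≤
        ENNReal.ofReal (1 - δ) * potential p root (ENNReal.ofReal a) (n + 1) s := by
    intro root n s hroot
    have h1 := h.transition_potential_add_le (n := n) hq.le hq1 hroot (ENNReal.ofReal a)
    set Y := potential p root (ENNReal.ofReal a) (n + 1) s with hY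
    have h2 : ENNReal.ofReal δ * Y ≤
        ENNReal.ofReal (p * q / 2) * ENNReal.ofReal a ^ level root s := by
      calc _ ≤ ENNReal.ofReal δ * (ENNReal.ofReal C * ENNReal.ofReal a ^ level root s) := by
            gcongr
            exact hbound root (n + 1) s hroot
        _ = _ := by
            rw [← mul_assoc, ← ENNReal.ofReal_mul hδ0.le, hδ, div_mul_cancel₀ _ hC0.ne']
    rw [ENNReal.ofReal_sub _ hδ0.le, ENNReal.ofReal_one,
      ENNReal.sub_mul (fun _ _ => hfin root (n + 1) s hroot), one_mul]
    refine ENNReal.le_sub_of_add_le_right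
      (ENNReal.mul_ne_top ENNReal.ofReal_ne_top (hfin root (n + 1) s hroot)) ?_
    exact le_trans (by gcongr) h1
  have hmeas : ∀ root n m, Measurable
      ((transition p)^[m] (potential p root (ENNReal.ofReal a) n)) := by
    intro root n m
    induction m with
    | zero => exact measurable_potential _
    | succ m ih =>
      rw [Function.iterate_succ_apply']
      exact measurable_transition ih
  -- Each transition lengthens the horizon of the potential by one; this is harmless because
  -- `hbound` does not depend on the horizon.
  have hiter : ∀ (root n m : ℕ) (s : State), root ∈ s.tree.verts →
      (transition p)^[m] (potential p root (ENNReal.ofReal a) n) s ≤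
        ENNReal.ofReal (1 - δ) ^ m * potential p root (ENNReal.ofReal a) (n + m) s := by
    intro root n m
    induction m with
    | zero => simp
    | succ m ih =>
      intro s hroot
      rw [Function.iterate_succ_apply']
      calc _ ≤ ∫⁻ s', ENNReal.ofReal (1 - δ) ^ m *
            potential p root (ENNReal.ofReal a) (n + m) s' ∂(stepKernel p s) :=
            lintegral_stepKernel_mono_of_root (hmeas root n m)
              ((measurable_potential _).const_mul _) hroot fun s' hs' _ => ih s' hs'
        _ = ENNReal.ofReal (1 - δ) ^ m *
            transition p (potential p root (ENNReal.ofReal a) (n + m)) s :=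
            lintegral_const_mul _ (measurable_potential _)
        _ ≤ _ := by
            rw [pow_succ, mul_assoc]
            gcongr
            exact hstep root (n + m) s hroot
  refine ⟨a, 1 - δ, C, ha0, ha1, by linarith, by linarith, hC0.le, fun root n s hroot => ?_⟩
  calc ∫⁻ ω, ENNReal.ofReal (a ^ level root (ω n)) ∂(law p s)
      ≤ ∫⁻ ω, potential p root (ENNReal.ofReal a) 0 (ω n) ∂(law p s) := by
        refine lintegral_mono fun ω => ?_
        refine le_trans ?_ (ENNReal.le_tsum (level root (ω n)))
        rw [hitProb_of_level_le le_rfl, mul_one, ENNReal.ofReal_pow ha0.le]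
    _ = (transition p)^[n] (potential p root (ENNReal.ofReal a) 0) s :=
        lintegral_law (measurable_potential _) n
    _ ≤ ENNReal.ofReal (1 - δ) ^ n * (ENNReal.ofReal C * ENNReal.ofReal a ^ level root s) :=
        (hiter root 0 n s hroot).trans (by gcongr; exact hbound root _ s hroot)
    _ ≤ ENNReal.ofReal (1 - δ) ^ n * (ENNReal.ofReal C * 1) := by
        gcongr
        exact pow_le_one' (by simpa using ha1.le) _
    _ = _ := by
        rw [mul_one, ← ENNReal.ofReal_pow (by linarith), ← ENNReal.ofReal_mul (by
          have : 0 < 1 - δ := by linarith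
          positivity), mul_comm]

lemma UniformEscape.exists_speed {q : ℝ} (h : UniformEscape p q) (hp : 0 < p) (hq : 0 < q)
    (hq1 : q ≤ 1) : ∃ c : ℝ, 0 < c ∧ ∀ (s : State) (root : ℕ), root ∈ s.tree.verts →
      ∀ᵐ ω ∂(law p s), (c : EReal) ≤ liminf
        (fun n : ℕ => ((((ω n).dist (ω n).walker root : ℝ) / (n : ℝ) : ℝ) : EReal)) atTop := by
  obtain ⟨a, lam, C, ha0, ha1, hlam0, hlam1, hC, hdecay⟩ := h.exists_contraction hp hq hq1
  have hla : Real.log a < 0 := Real.log_neg ha0 ha1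
  have hll : Real.log lam < 0 := Real.log_neg hlam0 hlam1
  -- Chosen so that `a ^ c` is the square root of `lam`: Markov's inequality for the event that the
  -- level is at most `c * n` costs only half of the exponential decay.
  set c : ℝ := Real.log lam / (2 * Real.log a) with hc
  have hc0 : 0 < c := div_pos_of_neg_of_neg hll (by linarith)
  have hca : a ^ c = lam ^ (1 / 2 : ℝ) := by
    rw [Real.rpow_def_of_pos ha0, Real.rpow_def_of_pos hlam0, hc]
    congr 1
    field_simp [hla.ne]
  set ρ : ℝ := lam ^ (1 / 2 : ℝ) with hρ
  have hρ0 : 0 < ρ := Real.rpow_pos_of_pos hlam0 _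
  have hρ1 : ρ < 1 := Real.rpow_lt_one hlam0.le hlam1 (by norm_num)
  have hρ2 : ρ * ρ = lam := by
    rw [hρ, ← Real.rpow_add hlam0]
    norm_num
  refine ⟨c, hc0, fun s root hroot => ?_⟩
  have hmark : ∀ n : ℕ, law p s {ω | (level root (ω n) : ℝ) ≤ c * n} ≤
      ENNReal.ofReal (C * ρ ^ n) := by
    intro n
    have hpos : 0 < ρ ^ n := pow_pos hρ0 n
    have h1 : {ω : ℕ → State | (level root (ω n) : ℝ) ≤ c * n} ⊆
        {ω | ENNReal.ofReal (ρ ^ n) ≤ ENNReal.ofReal (a ^ level root (ω n))} := by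
      intro ω hω
      apply ENNReal.ofReal_le_ofReal
      rw [← hca, ← Real.rpow_natCast, ← Real.rpow_mul ha0.le, ← Real.rpow_natCast a]
      exact Real.rpow_le_rpow_of_exponent_ge ha0 ha1.le hω
    have h2 := meas_ge_le_lintegral_div (μ := law p s)
      (f := fun ω => ENNReal.ofReal (a ^ level root (ω n))) (ε := ENNReal.ofReal (ρ ^ n))
      (by
        refine Measurable.aemeasurable (ENNReal.measurable_ofReal.comp ?_)
        exact (measurable_from_nat (f := fun k : ℕ => a ^ k)).comp
          ((measurable_level root).comp (measurable_pi_apply n)))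
      (by simpa using hpos) ENNReal.ofReal_ne_top
    refine (measure_mono h1).trans (h2.trans ?_)
    rw [ENNReal.div_le_iff (by simpa using hpos) ENNReal.ofReal_ne_top,
      ← ENNReal.ofReal_mul (by positivity)]
    refine (hdecay root n s hroot).trans (le_of_eq ?_)
    rw [mul_assoc, ← mul_pow, hρ2]
  have hsum : ∑' n : ℕ, law p s {ω | (level root (ω n) : ℝ) ≤ c * n} ≠ ⊤ := by
    refine ne_top_of_le_ne_top ?_ (ENNReal.tsum_le_tsum hmark)
    have hs : Summable fun n : ℕ => C * ρ ^ n :=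
      (summable_geometric_of_lt_one hρ0.le hρ1).mul_left C
    rw [← ENNReal.ofReal_tsum_of_nonneg (fun n => by positivity) hs]
    exact ENNReal.ofReal_ne_top
  filter_upwards [ae_eventually_notMem hsum] with ω hω
  refine le_liminf_of_le (by isBoundedDefault) ?_
  filter_upwards [hω, eventually_gt_atTop 0] with n hn hn0
  have hn : c * n < level root (ω n) := not_le.1 hn
  have hn0' : (0 : ℝ) < n := by exact_mod_cast hn0
  rw [EReal.coe_le_coe_iff, le_div_iff₀ hn0']
  exact hn.le

end BGRW

namespace BGRW

/-! A fair race between two players. -/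

/-- The probability that a fair coin shows `h` heads before it shows `j` tails. -/
noncomputable def fairRace : ℕ → ℕ → ℝ
  | 0, _ => 1
  | _ + 1, 0 => 0
  | h + 1, j + 1 => (fairRace h (j + 1) + fairRace (h + 1) j) / 2

@[simp] lemma fairRace_zero_left (j : ℕ) : fairRace 0 j = 1 := by
  cases j <;> simp [fairRace]

@[simp] lemma fairRace_succ_zero (h : ℕ) : fairRace (h + 1) 0 = 0 := by simp [fairRace]

lemma fairRace_succ_succ (h j : ℕ) :
    fairRace (h + 1) (j + 1) = (fairRace h (j + 1) + fairRace (h + 1) j) / 2 := by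
  simp [fairRace]

lemma fairRace_nonneg (h j : ℕ) : 0 ≤ fairRace h j := by
  fun_induction fairRace h j <;> linarith

lemma fairRace_le_one (h j : ℕ) : fairRace h j ≤ 1 := by
  fun_induction fairRace h j <;> linarith

lemma fairRace_succ_pos (h j : ℕ) : 0 < fairRace h (j + 1) := by
  induction h with
  | zero => simp
  | succ h ih =>
    rw [fairRace_succ_succ]
    linarith [fairRace_nonneg (h + 1) j]

/-- Exactly one side wins the race, and the coin is symmetric. -/
lemma fairRace_add_swap (h j : ℕ) : fairRace (h + 1) j + fairRace j (h + 1) = 1 := by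
  induction j generalizing h with
  | zero => simp
  | succ j ihj =>
    induction h with
    | zero =>
      have h1 := ihj 0
      have h2 : fairRace (j + 1) 0 = 0 := by simp
      rw [fairRace_succ_succ, fairRace_succ_succ, fairRace_zero_left, h2]
      linarith
    | succ h ih =>
      rw [fairRace_succ_succ (h + 1) j, fairRace_succ_succ j (h + 1)]
      linarith [ihj (h + 1)]

lemma fairRace_self (h : ℕ) : fairRace (h + 1) (h + 1) = 1 / 2 := by
  linarith [fairRace_add_swap h (h + 1)]

/-- The difference is the probability that toss number `h + j + 1` shows tail number `j + 1`, after
exactly `h` heads. -/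
lemma fairRace_sub_succ (h j : ℕ) :
    fairRace h (j + 1) - fairRace (h + 1) (j + 1) = ((h + j).choose h : ℝ) / 2 ^ (h + j + 1) := by
  induction h generalizing j with
  | zero =>
    induction j with
    | zero => norm_num [fairRace_succ_succ]
    | succ j ih =>
      simp only [fairRace_zero_left, Nat.choose_zero_right, Nat.cast_one, zero_add] at ih ⊢
      rw [fairRace_succ_succ, fairRace_zero_left, pow_succ]
      field_simp at ih ⊢
      linarith
  | succ h ihh =>
    induction j with
    | zero =>
      have h1 := ihh 0
      rw [fairRace_succ_succ (h + 1) 0, fairRace_succ_zero]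
      rw [fairRace_succ_succ h 0, fairRace_succ_zero] at h1 ⊢
      simp only [add_zero, Nat.choose_self, Nat.cast_one] at h1 ⊢
      rw [pow_succ]
      field_simp at h1 ⊢
      linarith
    | succ j ih =>
      have h1 := ihh (j + 1)
      rw [fairRace_succ_succ h (j + 1), fairRace_succ_succ (h + 1) (j + 1)]
      have h2 : (h + 1 + (j + 1)).choose (h + 1) =
          (h + (j + 1)).choose h + (h + 1 + j).choose (h + 1) := by
        rw [show h + 1 + (j + 1) = (h + (j + 1)) + 1 by omega, Nat.choose_succ_succ,
          show h + (j + 1) = h + 1 + j by omega]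
      rw [h2]
      push_cast
      rw [show h + 1 + (j + 1) + 1 = (h + (j + 1) + 1) + 1 by omega, pow_succ]
      rw [show h + 1 + j + 1 = h + (j + 1) + 1 by omega] at ih
      field_simp at h1 ih ⊢
      linarith

/-! ### Binomial estimates and a lower bound for the race. -/

lemma centralBinom_sq_mul_le (m : ℕ) : m.centralBinom ^ 2 * (2 * m + 1) ≤ 16 ^ m := by
  induction m with
  | zero => simp
  | succ m ih =>
    have h := Nat.succ_mul_centralBinom_succ m
    refine Nat.le_of_mul_le_mul_left ?_ (show 0 < (m + 1) ^ 2 by positivity)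
    calc (m + 1) ^ 2 * ((m + 1).centralBinom ^ 2 * (2 * (m + 1) + 1))
        = ((m + 1) * (m + 1).centralBinom) ^ 2 * (2 * m + 3) := by ring
      _ = m.centralBinom ^ 2 * (2 * m + 1) * (4 * ((2 * m + 1) * (2 * m + 3))) := by
          rw [h]; ring
      _ ≤ 16 ^ m * (4 * (4 * (m + 1) ^ 2)) := by
          refine Nat.mul_le_mul ih ?_
          nlinarith
      _ = (m + 1) ^ 2 * 16 ^ (m + 1) := by ring

lemma choose_sq_mul_le (n k : ℕ) : n.choose k ^ 2 * n ≤ 4 ^ n := by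
  obtain ⟨m, rfl | rfl⟩ := Nat.even_or_odd' n
  · calc (2 * m).choose k ^ 2 * (2 * m) ≤ m.centralBinom ^ 2 * (2 * m + 1) := by
          gcongr
          · exact Nat.choose_le_centralBinom k m
          · omega
      _ ≤ 16 ^ m := centralBinom_sq_mul_le m
      _ = 4 ^ (2 * m) := by rw [pow_mul]; norm_num
  · have h : (2 * m + 1).choose k ≤ 2 * m.centralBinom := by
      cases k with
      | zero => simpa using Nat.le_trans (Nat.centralBinom_pos m) (by omega)
      | succ k =>
        rw [Nat.choose_succ_succ]
        have := Nat.choose_le_centralBinom k m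
        have := Nat.choose_le_centralBinom (k + 1) m
        simp only [Nat.succ_eq_add_one]
        omega
    calc (2 * m + 1).choose k ^ 2 * (2 * m + 1) ≤ (2 * m.centralBinom) ^ 2 * (2 * m + 1) := by
          gcongr
      _ = 4 * (m.centralBinom ^ 2 * (2 * m + 1)) := by ring
      _ ≤ 4 * 16 ^ m := by gcongr; exact centralBinom_sq_mul_le m
      _ = 4 ^ (2 * m + 1) := by rw [pow_succ, pow_mul]; norm_num; ring

lemma choose_div_two_pow_le {n k : ℕ} {x : ℝ} (hx : 0 < x) (hn : x ^ 2 ≤ n) :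
    (n.choose k : ℝ) / 2 ^ n ≤ 1 / x := by
  have h1 : ((n.choose k : ℝ)) ^ 2 * n ≤ (2 ^ n) ^ 2 := by
    have : ((n.choose k ^ 2 * n : ℕ) : ℝ) ≤ ((4 ^ n : ℕ) : ℝ) :=
      Nat.cast_le.2 (choose_sq_mul_le n k)
    push_cast at this
    rw [← pow_mul, mul_comm n 2, pow_mul]
    norm_num
    exact this
  rw [div_le_div_iff₀ (by positivity) hx, one_mul]
  refine le_of_sq_le_sq ?_ (by positivity)
  calc ((n.choose k : ℝ) * x) ^ 2 = (n.choose k : ℝ) ^ 2 * x ^ 2 := by ring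
    _ ≤ (n.choose k : ℝ) ^ 2 * n := by gcongr
    _ ≤ _ := h1

/-- The balanced race has probability `1/2`. Each of the `b` extra heads costs at most `1 / (4 *
b)`, since a binomial weight of at least `4 * b ^ 2` tosses is at most `1 / (2 * b)`. -/
lemma fairRace_ge (b : ℕ) (hb : 0 < b) : 1 / 4 ≤ fairRace (4 * b ^ 2 + b) (4 * b ^ 2) := by
  have hb' : (0 : ℝ) < b := by exact_mod_cast hb
  obtain ⟨e, he⟩ : ∃ e, 4 * b ^ 2 = e + 1 := ⟨4 * b ^ 2 - 1, by
    have : 0 < 4 * b ^ 2 := by positivity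
    omega⟩
  have key : ∀ i : ℕ, 1 / 2 - i * (1 / (4 * b)) ≤ fairRace (e + 1 + i) (e + 1) := by
    intro i
    induction i with
    | zero => simp [fairRace_self]
    | succ i ih =>
      have h1 := fairRace_sub_succ (e + 1 + i) e
      have h2 : (((e + 1 + i + e).choose (e + 1 + i) : ℕ) : ℝ) / 2 ^ (e + 1 + i + e) ≤
          1 / (2 * b) := by
        refine choose_div_two_pow_le (by positivity) ?_
        have : (2 * b) ^ 2 ≤ e + 1 + i + e := by
          rw [mul_pow]
          omega
        exact_mod_cast this
      rw [pow_succ, ← div_div] at h1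
      have h3 : (1 : ℝ) / (4 * b) = 1 / (2 * b) / 2 := by
        rw [div_div]
        ring
      push_cast
      rw [← add_assoc]
      linarith
  have h := key b
  have h4 : (b : ℝ) * (1 / (4 * b)) = 1 / 4 := by field_simp
  rw [he]
  linarith

/-! The race between the children of a vertex and its parent. -/

open Finset

/-- Auxiliary definition of `race`, with a bound on the number of rounds. -/
noncomputable def raceAux (M : ℕ) (S : Finset ℕ) (y : ℕ → ℝ) : ℕ → ℕ → (ℕ → ℕ) → ℝ
  | 0, _, t => ∏ c ∈ S with M ≤ t c, y c
  | _ + 1, 0, t => ∏ c ∈ S with M ≤ t c, y c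
  | N + 1, j + 1, t => (raceAux M S y N j t + ∑ c ∈ S with t c < M,
      raceAux M S y N (j + 1) (Function.update t c (t c + 1))) / ((#{c ∈ S | t c < M} : ℝ) + 1)

/-- In each round a uniformly chosen player among the players in `S` with a score less than `M` and
one more player, the parent, scores. The race ends when the parent has scored `j` times. The value
of the race is the expectation of the product of `y` over the players whose score is then `M`;
the initial scores are given by `t`. -/
noncomputable def race (M j : ℕ) (S : Finset ℕ) (t : ℕ → ℕ) (y : ℕ → ℝ) : ℝ :=
  raceAux M S y (j + ∑ c ∈ S, (M - t c)) j t

variable {M j : ℕ} {S : Finset ℕ} {t t' : ℕ → ℕ} {y y' : ℕ → ℝ}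

lemma race_zero : race M 0 S t y = ∏ c ∈ S with M ≤ t c, y c := by
  unfold race
  cases 0 + ∑ c ∈ S, (M - t c) <;> simp [raceAux]

/-- The number of missing scores, parent included, drops by exactly one per round, so the bound on
the rounds built into `race` matches on both sides. -/
lemma race_succ : ((#{c ∈ S | t c < M} : ℝ) + 1) * race M (j + 1) S t y =
    race M j S t y + ∑ c ∈ S with t c < M,
      race M (j + 1) S (Function.update t c (t c + 1)) y := by
  have h : ∀ c ∈ S.filter (fun c => t c < M),
      j + 1 + ∑ c' ∈ S, (M - Function.update t c (t c + 1) c') = j + ∑ c' ∈ S, (M - t c') := by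
    intro c hc
    rw [mem_filter] at hc
    rw [← Finset.add_sum_erase _ _ hc.1, ← Finset.add_sum_erase _ (fun c' => M - t c') hc.1,
      Function.update_self, Finset.sum_congr rfl (g := fun c' => M - t c')]
    · omega
    · intro c' hc'
      rw [Function.update_of_ne (Finset.ne_of_mem_erase hc')]
  unfold race
  rw [show j + 1 + ∑ c ∈ S, (M - t c) = (j + ∑ c ∈ S, (M - t c)) + 1 by omega, raceAux]
  field_simp
  exact congrArg _ (Finset.sum_congr rfl fun c hc => by rw [h c hc])

/-- Induction principle for properties of `race`. -/
lemma race_induction {P : ℕ → (ℕ → ℕ) → Prop} (M : ℕ) (S : Finset ℕ) (h0 : ∀ t, P 0 t)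
    (hs : ∀ j t, P j t → (∀ c ∈ S, t c < M → P (j + 1) (Function.update t c (t c + 1))) →
      P (j + 1) t) (j : ℕ) (t : ℕ → ℕ) : P j t := by
  obtain ⟨N, hN⟩ : ∃ N, j + ∑ c ∈ S, (M - t c) = N := ⟨_, rfl⟩
  induction N using Nat.strong_induction_on generalizing j t with
  | _ N ih =>
    cases j with
    | zero => exact h0 t
    | succ j =>
      refine hs j t (ih _ ?_ j t rfl) fun c hc hcM => ih _ ?_ (j + 1) _ rfl
      · omega
      · have : ∑ c' ∈ S, (M - Function.update t c (t c + 1) c') < ∑ c' ∈ S, (M - t c') := by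
          refine Finset.sum_lt_sum (fun c' _ => ?_) ⟨c, hc, ?_⟩
          · by_cases h : c' = c
            · subst h
              rw [Function.update_self]
              omega
            · rw [Function.update_of_ne h]
          · rw [Function.update_self]
            omega
        omega

lemma race_succ_eq : race M (j + 1) S t y = (race M j S t y + ∑ c ∈ S with t c < M,
      race M (j + 1) S (Function.update t c (t c + 1)) y) / ((#{c ∈ S | t c < M} : ℝ) + 1) := by
  rw [← race_succ]
  field_simp

lemma race_congr (ht : ∀ c ∈ S, t c = t' c) (hy : ∀ c ∈ S, y c = y' c) :
    race M j S t y = race M j S t' y' := by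
  refine race_induction M S (P := fun j t => ∀ t' : ℕ → ℕ, (∀ c ∈ S, t c = t' c) →
    race M j S t y = race M j S t' y') ?_ ?_ j t t' ht
  · intro t t' ht
    rw [race_zero, race_zero, Finset.filter_congr fun c hc => by rw [ht c hc]]
    exact Finset.prod_congr rfl fun c hc => hy c (mem_filter.1 hc).1
  · intro j t h1 h2 t' ht
    have hf : S.filter (fun c => t c < M) = S.filter (fun c => t' c < M) :=
      Finset.filter_congr fun c hc => by rw [ht c hc]
    rw [race_succ_eq, race_succ_eq, h1 t' ht, ← hf]
    congr 2
    refine Finset.sum_congr rfl fun c hc => h2 c (mem_filter.1 hc).1 (mem_filter.1 hc).2 _ ?_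
    intro c' hc'
    rw [ht c (mem_filter.1 hc).1]
    by_cases h : c' = c
    · subst h
      simp
    · rw [Function.update_of_ne h, Function.update_of_ne h, ht c' hc']

lemma race_nonneg (hy : ∀ c ∈ S, 0 ≤ y c) : 0 ≤ race M j S t y := by
  refine race_induction M S (P := fun j t => 0 ≤ race M j S t y) ?_ ?_ j t
  · intro t
    rw [race_zero]
    exact Finset.prod_nonneg fun c hc => hy c (mem_filter.1 hc).1
  · intro j t h1 h2
    rw [race_succ_eq]
    have := Finset.sum_nonneg fun c (hc : c ∈ S.filter fun c => t c < M) =>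
      h2 c (mem_filter.1 hc).1 (mem_filter.1 hc).2
    positivity

lemma race_mono (hy : ∀ c ∈ S, 0 ≤ y c) (hyy : ∀ c ∈ S, y c ≤ y' c) :
    race M j S t y ≤ race M j S t y' := by
  refine race_induction M S (P := fun j t => race M j S t y ≤ race M j S t y') ?_ ?_ j t
  · intro t
    rw [race_zero, race_zero]
    exact Finset.prod_le_prod (fun c hc => hy c (mem_filter.1 hc).1)
      fun c hc => hyy c (mem_filter.1 hc).1
  · intro j t h1 h2
    rw [race_succ_eq, race_succ_eq]
    gcongr with c hc
    exact h2 c (mem_filter.1 hc).1 (mem_filter.1 hc).2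

/-- Each final product contains `y v` at most once, and averaging preserves affine functions with
nonnegative slope. -/
lemma race_update_affine (hy : ∀ c ∈ S, 0 ≤ y c) (v : ℕ) :
    ∃ A B : ℝ, 0 ≤ B ∧ ∀ z, race M j S t (Function.update y v z) = A + B * z := by
  refine race_induction M S (P := fun j t => ∃ A B : ℝ, 0 ≤ B ∧
    ∀ z, race M j S t (Function.update y v z) = A + B * z) ?_ ?_ j t
  · intro t
    simp only [race_zero]
    by_cases hv : v ∈ S.filter fun c => M ≤ t c
    · refine ⟨0, ∏ c ∈ (S.filter fun c => M ≤ t c) \ {v}, y c, Finset.prod_nonneg fun c hc =>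
        hy c (mem_filter.1 (mem_sdiff.1 hc).1).1, fun z => ?_⟩
      rw [Finset.prod_update_of_mem hv, zero_add, mul_comm]
    · refine ⟨∏ c ∈ S with M ≤ t c, y c, 0, le_rfl, fun z => ?_⟩
      rw [Finset.prod_update_of_notMem hv]
      simp
  · intro j t h1 h2
    obtain ⟨A, B, hB, h1⟩ := h1
    have h3 : ∀ c, ∃ A B : ℝ, 0 ≤ B ∧ (c ∈ S → t c < M → ∀ z,
        race M (j + 1) S (Function.update t c (t c + 1)) (Function.update y v z) = A + B * z) := by
      intro c
      by_cases hc : c ∈ S ∧ t c < M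
      · obtain ⟨A, B, hB, h⟩ := h2 c hc.1 hc.2
        exact ⟨A, B, hB, fun _ _ => h⟩
      · exact ⟨0, 0, le_rfl, fun h h' => absurd ⟨h, h'⟩ hc⟩
    choose A' B' hB' h3 using h3
    refine ⟨(A + ∑ c ∈ S with t c < M, A' c) / ((#{c ∈ S | t c < M} : ℝ) + 1),
      (B + ∑ c ∈ S with t c < M, B' c) / ((#{c ∈ S | t c < M} : ℝ) + 1), ?_, fun z => ?_⟩
    · have := Finset.sum_nonneg fun c (_ : c ∈ S.filter fun c => t c < M) => hB' c
      positivity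
    · rw [race_succ_eq, h1 z, Finset.sum_congr rfl fun c hc =>
        h3 c (mem_filter.1 hc).1 (mem_filter.1 hc).2 z, Finset.sum_add_distrib, ← Finset.sum_mul]
      ring

/-- By Bernoulli's inequality the power is at most `1 / (1 + k * r)`, and `1 / (1 + x) ≤ 1 - x / 2`
on the unit interval. -/
lemma one_sub_pow_le {r : ℝ} {k : ℕ} (hr : 0 ≤ r) (hr1 : r ≤ 1) (hk : k * r ≤ 1) :
    (1 - r) ^ k ≤ 1 - r / 2 * k := by
  have h1 : 1 + k * r ≤ (1 + r) ^ k := one_add_mul_le_pow (by linarith) k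
  have h2 : (1 - r) ^ k * (1 + r) ^ k ≤ 1 := by
    rw [← mul_pow]
    exact pow_le_one₀ (by nlinarith) (by nlinarith)
  have h3 : 0 ≤ (1 - r) ^ k := pow_nonneg (by linarith) k
  have h4 : 0 ≤ (k : ℝ) * r := by positivity
  have h5 : (1 - r) ^ k * (1 + k * r) ≤ 1 := le_trans (by gcongr) h2
  nlinarith

/-- When the race ends, `(1 - r) ^ k ≤ 1 - r / 2 * k` for the number `k` of finished players. The
expectation of `k` is a sum of fair race probabilities: rounds won by third players do not affect
the duel of `c` with the parent, in which both score with equal probability. -/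
lemma race_const_le {r : ℝ} (hr : 0 ≤ r) (hr1 : r ≤ 1) (hS : (#S : ℝ) * r ≤ 1) :
    race M j S t (fun _ => 1 - r) ≤ 1 - r / 2 * ∑ c ∈ S, fairRace (M - t c) j := by
  refine race_induction M S (P := fun j t => race M j S t (fun _ => 1 - r) ≤
    1 - r / 2 * ∑ c ∈ S, fairRace (M - t c) j) ?_ ?_ j t
  · intro t
    rw [race_zero, Finset.prod_const]
    have h1 : ∑ c ∈ S, fairRace (M - t c) 0 = #{c ∈ S | M ≤ t c} := by
      rw [Finset.card_filter]
      push_cast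
      refine Finset.sum_congr rfl fun c _ => ?_
      split_ifs with h
      · rw [Nat.sub_eq_zero_of_le h, fairRace_zero_left]
      · obtain ⟨k, hk⟩ : ∃ k, M - t c = k + 1 := ⟨M - t c - 1, by omega⟩
        rw [hk, fairRace_succ_zero]
    rw [h1]
    refine one_sub_pow_le hr hr1 (le_trans ?_ hS)
    gcongr
    exact Finset.filter_subset _ _
  · intro j t h1 h2
    set act := S.filter fun c => t c < M with hact
    have hsum : ∑ c ∈ act, race M (j + 1) S (Function.update t c (t c + 1)) (fun _ => 1 - r) ≤
        ∑ c ∈ act, (1 - r / 2 * ∑ c' ∈ S,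
          fairRace (M - Function.update t c (t c + 1) c') (j + 1)) :=
      Finset.sum_le_sum fun c hc => h2 c (mem_filter.1 hc).1 (mem_filter.1 hc).2
    have h3 : ∑ c ∈ act, ∑ c' ∈ S, fairRace (M - Function.update t c (t c + 1) c') (j + 1) +
        ∑ c ∈ S, fairRace (M - t c) j = (#act + 1) * ∑ c ∈ S, fairRace (M - t c) (j + 1) := by
      rw [Finset.sum_comm, ← Finset.sum_add_distrib, Finset.mul_sum]
      refine Finset.sum_congr rfl fun c hc => ?_
      by_cases hcM : t c < M
      · have hca : c ∈ act := mem_filter.2 ⟨hc, hcM⟩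
        obtain ⟨k, hk⟩ : ∃ k, M - t c = k + 1 := ⟨M - t c - 1, by omega⟩
        have h4 : ∑ x ∈ act.erase c, fairRace (M - Function.update t x (t x + 1) c) (j + 1) =
            ((#act : ℝ) - 1) * fairRace (k + 1) (j + 1) := by
          rw [Finset.sum_congr rfl (g := fun _ => fairRace (k + 1) (j + 1)), Finset.sum_const,
            Finset.card_erase_of_mem hca, nsmul_eq_mul, Nat.cast_sub (Finset.card_pos.2 ⟨c, hca⟩)]
          · simp
          · intro x hx
            rw [Function.update_of_ne (Finset.ne_of_mem_erase hx).symm, hk]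
        rw [← Finset.add_sum_erase _ _ hca, h4, Function.update_self,
          show M - (t c + 1) = k by omega, hk]
        have h5 := fairRace_succ_succ k j
        linarith
      · have h0 : M - t c = 0 := by omega
        have h4 : ∀ x ∈ act, fairRace (M - Function.update t x (t x + 1) c) (j + 1) = 1 := by
          intro x hx
          have hne : c ≠ x := by
            rintro rfl
            exact hcM (mem_filter.1 hx).2
          rw [Function.update_of_ne hne, h0, fairRace_zero_left]
        rw [Finset.sum_congr rfl h4, h0]
        simp
    rw [race_succ_eq, div_le_iff₀ (by positivity)]
    rw [Finset.sum_sub_distrib, Finset.sum_const, nsmul_eq_mul, mul_one, ← Finset.mul_sum] at hsum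
    have h6 : (1 - r / 2 * ∑ c ∈ S, fairRace (M - t c) (j + 1)) * ((#act : ℝ) + 1) =
        (#act : ℝ) + 1 - r / 2 * ((#act + 1) * ∑ c ∈ S, fairRace (M - t c) (j + 1)) := by ring
    rw [h6, ← h3]
    linarith

end BGRW

namespace BGRW

open State

/-! Children and descendants in the rooted tree of a state. -/

/-- `c` is a child of `a` in the tree of `s` rooted at `root`. -/
def IsChild (root : ℕ) (s : State) (a c : ℕ) : Prop :=
  s.tree.Adj a c ∧ s.dist c root = s.dist a root + 1

section Child

variable {root : ℕ} {s : State} {a a' c v x y : ℕ}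

lemma IsChild.parent_unique (hroot : root ∈ s.tree.verts) (h : IsChild root s a c)
    (h' : IsChild root s a' c) : a = a' :=
  s.eq_of_adj_of_dist hroot h.1.symm h'.1.symm h.2 h'.2

lemma IsChild.grow (hroot : root ∈ s.tree.verts) (h : IsChild root s a c) :
    IsChild root s.grow a c := by
  refine ⟨s.adj_grow.2 (Or.inl h.1), ?_⟩
  rw [s.dist_grow hroot (s.tree.edge_vert h.1), s.dist_grow hroot (s.tree.edge_vert h.1.symm), h.2]

lemma isChild_newVertex (hroot : root ∈ s.tree.verts) :
    IsChild root s.grow s.walker s.newVertex := by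
  refine ⟨s.adj_grow.2 (Or.inr (Or.inl ⟨rfl, rfl⟩)), ?_⟩
  rw [s.dist_newVertex hroot, s.dist_grow hroot s.walker_mem]

@[simp] lemma isChild_moveTo : IsChild root (s.moveTo y) a c ↔ IsChild root s a c := by
  simp [IsChild, tree_moveTo]

lemma isChild_or_of_adj (hroot : root ∈ s.tree.verts) (h : s.tree.Adj x y) :
    IsChild root s x y ∨ IsChild root s y x := by
  rcases s.dist_of_adj hroot h with h' | h'
  · exact Or.inr ⟨h.symm, h'⟩
  · exact Or.inl ⟨h, h'⟩

/-- `x` is a descendant of `v` in the tree of `s` rooted at `root`. -/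
def IsDescendant (root : ℕ) (s : State) : ℕ → ℕ → Prop := Relation.ReflTransGen (IsChild root s)

lemma IsDescendant.dist_le (h : IsDescendant root s v x) : s.dist v root ≤ s.dist x root := by
  induction h with
  | refl => exact le_rfl
  | tail _ h ih => exact ih.trans (by rw [h.2]; omega)

lemma IsDescendant.parent (hroot : root ∈ s.tree.verts) (h : IsDescendant root s v x)
    (hne : x ≠ v) (hy : IsChild root s y x) : IsDescendant root s v y := by
  rcases Relation.ReflTransGen.cases_tail h with h | ⟨w, hw, hwx⟩
  · exact absurd h hne
  · rwa [hy.parent_unique hroot hwx]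

lemma IsDescendant.grow (hroot : root ∈ s.tree.verts) (h : IsDescendant root s v x) :
    IsDescendant root s.grow v x := by
  induction h with
  | refl => exact Relation.ReflTransGen.refl
  | tail _ h ih => exact Relation.ReflTransGen.tail ih (h.grow hroot)

lemma isDescendant_moveTo : IsDescendant root (s.moveTo y) v x ↔ IsDescendant root s v x := by
  have : IsChild root (s.moveTo y) = IsChild root s := by
    ext
    simp
  rw [IsDescendant, this, IsDescendant]

end Child

/-! The bookkeeping of entries. -/

/-- Parameters of the bookkeeping: a vertex is entered up to `M` times; during the first `b` visits
from its parent only the birth of children is recorded, afterwards the recorded children race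
against the parent. The number `r` is a lower bound for the probability that one of `M` visits to a
fresh vertex never ends. -/
structure Params (p : unitInterval) where
  M : ℕ
  b : ℕ
  r : ℝ
  b_lt : b < M
  r_pos : 0 < r
  r_le : r ≤ 1
  b_mul_r : b * r ≤ 1
  gain : 2 ≤ fairRace M (M - b) * (p * b)

/-- With `M = 4 * b ^ 2 + b` the race probability is at least `1/4`, so `gain` needs only `p * b ≥
8`; then `r = 1 / b` is admissible. -/
lemma exists_params (p : unitInterval) (hp : 0 < p) : Nonempty (Params p) := by
  have hp0 : (0 : ℝ) < p := hp
  obtain ⟨n, hn⟩ := exists_nat_ge (8 / (p : ℝ))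
  have hb : 0 < n + 1 := n.succ_pos
  refine ⟨⟨4 * (n + 1) ^ 2 + (n + 1), n + 1, 1 / ((n + 1 : ℕ) : ℝ), ?_, by positivity, ?_, ?_, ?_⟩⟩
  · have : 0 < 4 * (n + 1) ^ 2 := by positivity
    omega
  · rw [div_le_one (by positivity)]
    push_cast
    linarith [n.cast_nonneg (α := ℝ)]
  · exact le_of_eq (mul_one_div_cancel (by positivity))
  · rw [Nat.add_sub_cancel]
    have h1 := fairRace_ge (n + 1) hb
    have h2 : 8 ≤ p * ((n + 1 : ℕ) : ℝ) := by
      rw [div_le_iff₀ hp0] at hn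
      push_cast
      nlinarith
    nlinarith

/-- Labels of the vertices: the number of entries from the parent, the recorded children, and a
bound for the probability that all of the remaining visits end. -/
structure Labels where
  count : ℕ → ℕ
  cand : ℕ → Finset ℕ
  val : ℕ → ℝ

/-- Change of the value at a vertex. -/
def Labels.setVal (L : Labels) (v : ℕ) (z : ℝ) : Labels :=
  { L with val := Function.update L.val v z }

/-- Registration of an entry. -/
def Labels.enter (L : Labels) (c : ℕ) : Labels :=
  { L with count := Function.update L.count c (L.count c + 1) }

/-- Registration of a child. -/
def Labels.addCand (L : Labels) (v c : ℕ) : Labels :=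
  { L with cand := Function.update L.cand v (insert c (L.cand v)) }

variable {p : unitInterval} (P : Params p)

/-- The value of a vertex which has been entered `t ≤ b` times and has `n` recorded children. -/
noncomputable def Params.birth (t n : ℕ) : ℝ :=
  1 - P.r / 2 * fairRace P.M (P.M - P.b) * (n + p * (P.b - t))

/-- The value of a vertex during a visit. -/
noncomputable def Params.valIn (L : Labels) (v : ℕ) : ℝ :=
  if L.count v ≤ P.b then P.birth (L.count v) (L.cand v).card
  else race P.M (P.M - L.count v + 1) (L.cand v) L.count L.val

/-- The value of a vertex between two visits. -/
noncomputable def Params.valAway (L : Labels) (v : ℕ) : ℝ :=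
  if L.count v ≤ P.b then P.birth (L.count v) (L.cand v).card
  else race P.M (P.M - L.count v) (L.cand v) L.count L.val

/-- The value of the last vertex of a path, as a function of the value `z` of its first vertex. -/
noncomputable def Params.lift (L : Labels) : ℕ → List ℕ → ℝ → ℝ
  | _, [], z => z
  | v, u :: rest, z => Params.lift L u rest (P.valIn (L.setVal v z) u)

variable {P} {L L' : Labels}

lemma Params.birth_nonneg {t n : ℕ} (hn : n ≤ t) (ht : t ≤ P.b) : 0 ≤ P.birth t n := by
  have h1 : (n : ℝ) ≤ t := by exact_mod_cast hn
  have h2 : (t : ℝ) ≤ P.b := by exact_mod_cast ht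
  have h3 := fairRace_nonneg P.M (P.M - P.b)
  have h4 := fairRace_le_one P.M (P.M - P.b)
  have h5 := P.r_pos
  have h6 := P.b_mul_r
  have hp0 := p.2.1
  have hp1 := p.2.2
  have h7 : (n : ℝ) + p * (P.b - t) ≤ P.b := by nlinarith
  have h8 : 0 ≤ (n : ℝ) + p * (P.b - t) := by
    have : 0 ≤ (p : ℝ) * (P.b - t) := mul_nonneg hp0 (by linarith)
    positivity
  have h9 : fairRace P.M (P.M - P.b) * (n + p * (P.b - t)) ≤ P.b := by nlinarith
  unfold Params.birth
  nlinarith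

/-- The self-consistency of `r`: the value computed for a fresh vertex from its future children is
no worse than the value assumed for fresh children. -/
lemma Params.birth_zero_le : P.birth 0 0 ≤ 1 - P.r := by
  have h1 := P.gain
  have h2 := P.r_pos
  unfold Params.birth
  push_cast
  nlinarith

/-- An early entry replaces an expected birth, of weight `p`, by its actual outcome. -/
lemma Params.birth_step (t n : ℕ) :
    p * P.birth (t + 1) (n + 1) + (1 - p) * P.birth (t + 1) n = P.birth t n := by
  unfold Params.birth
  push_cast
  ring

lemma Params.valIn_congr {v : ℕ} (h1 : L.count v = L'.count v) (h2 : L.cand v = L'.cand v)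
    (h3 : ∀ c ∈ L.cand v, L.count c = L'.count c ∧ L.val c = L'.val c) :
    P.valIn L v = P.valIn L' v := by
  unfold Params.valIn
  rw [← h1, ← h2, race_congr (fun c hc => (h3 c hc).1) (fun c hc => (h3 c hc).2)]

lemma Params.valAway_congr {v : ℕ} (h1 : L.count v = L'.count v) (h2 : L.cand v = L'.cand v)
    (h3 : ∀ c ∈ L.cand v, L.count c = L'.count c ∧ L.val c = L'.val c) :
    P.valAway L v = P.valAway L' v := by
  unfold Params.valAway
  rw [← h1, ← h2, race_congr (fun c hc => (h3 c hc).1) (fun c hc => (h3 c hc).2)]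

lemma Params.lift_congr {v : ℕ} {rest : List ℕ} (h : ∀ u ∈ rest, L.count u = L'.count u ∧
    L.cand u = L'.cand u ∧ ∀ c ∈ L.cand u, L.count c = L'.count c ∧ L.val c = L'.val c) (z : ℝ) :
    P.lift L v rest z = P.lift L' v rest z := by
  induction rest generalizing v z with
  | nil => rfl
  | cons u rest ih =>
    have hu := h u List.mem_cons_self
    rw [Params.lift, Params.lift, ih fun u hu => h u (List.mem_cons_of_mem _ hu)]
    congr 1
    refine Params.valIn_congr hu.1 hu.2.1 fun c hc => ⟨(hu.2.2 c hc).1, ?_⟩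
    by_cases hcv : c = v
    · simp [Labels.setVal, hcv]
    · simp [Labels.setVal, hcv, (hu.2.2 c hc).2]

lemma Params.valIn_affine (hL : ∀ u, 0 ≤ L.val u) (v u : ℕ) :
    ∃ A B : ℝ, 0 ≤ B ∧ ∀ z, P.valIn (L.setVal v z) u = A + B * z := by
  unfold Params.valIn Labels.setVal
  dsimp only
  split_ifs
  · exact ⟨_, 0, le_rfl, fun z => by rw [zero_mul, add_zero]⟩
  · exact race_update_affine (fun c _ => hL c) v

/-- Affinity lets averages over one step of the walk be taken at the vertex being visited and then
carried down the path. -/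
lemma Params.lift_affine (hL : ∀ u, 0 ≤ L.val u) (v : ℕ) (rest : List ℕ) :
    ∃ A B : ℝ, 0 ≤ B ∧ ∀ z, P.lift L v rest z = A + B * z := by
  induction rest generalizing v with
  | nil => exact ⟨0, 1, zero_le_one, fun z => by simp [Params.lift]⟩
  | cons u rest ih =>
    obtain ⟨A, B, hB, h⟩ := ih u
    obtain ⟨A', B', hB', h'⟩ := Params.valIn_affine (P := P) hL v u
    refine ⟨A + B * A', B * B', by positivity, fun z => ?_⟩
    rw [Params.lift, h, h']
    ring

lemma Params.lift_mono (hL : ∀ u, 0 ≤ L.val u) (v : ℕ) (rest : List ℕ) :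
    Monotone (P.lift L v rest) := by
  obtain ⟨A, B, hB, h⟩ := Params.lift_affine (P := P) hL v rest
  intro z z' hz
  rw [h, h]
  gcongr

variable (P) in
/-- The state `s` is compatible with the labels `L` and with the path `v :: rest` from the vertex
whose visit is in progress down to a vertex at level `j + 1`. -/
structure Tracking (root j : ℕ) (s : State) (L : Labels) (v : ℕ) (rest : List ℕ) : Prop where
  root_mem : root ∈ s.tree.verts
  child : ∀ u, ∀ c ∈ L.cand u, IsChild root s u c
  fresh : ∀ u, L.count u ≤ P.b → ∀ c ∈ L.cand u, L.count c = 0 ∧ L.val c = 1 - P.r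
  card_le : ∀ u, L.count u ≤ P.b → (L.cand u).card ≤ L.count u
  nonneg : ∀ u, 0 ≤ L.val u
  count_le : ∀ u, L.count u ≤ P.M
  away : ∀ c, c ∉ v :: rest → P.valAway L c ≤ L.val c
  done : ∀ c, c ∉ v :: rest → L.count c = P.M → L.val c = 1
  unused : ∀ u, u ∉ s.tree.verts → L.count u = 0 ∧ L.cand u = ∅ ∧ L.val u = 1 - P.r
  chain : (v :: rest).IsChain fun a u => a ∈ L.cand u
  busy : ∀ u ∈ rest, P.b < L.count u
  last : ∃ u ∈ (v :: rest).getLast?, L.count u = P.M ∧ s.dist u root = j + 1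
  desc : IsDescendant root s v s.walker

/-! ### The invariant of the bookkeeping under growth, exits, entries and births. -/

namespace Tracking

variable {root j : ℕ} {s : State} {v u c : ℕ} {rest : List ℕ}

lemma dist_lt (h : Tracking P root j s L v rest) : ∀ u ∈ rest, s.dist u root < s.dist v root := by
  have h1 : (v :: rest).IsChain fun a u => s.dist u root < s.dist a root :=
    h.chain.imp fun a u hau => by
      rw [(h.child u a hau).2]
      omega
  have : IsTrans ℕ fun a u => s.dist u root < s.dist a root := ⟨fun _ _ _ h h' => h'.trans h⟩
  exact (List.pairwise_cons.1 h1.pairwise).1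

lemma notMem_of_lt (h : Tracking P root j s L v rest) (hc : s.dist v root < s.dist c root) :
    c ∉ v :: rest := by
  intro hmem
  rcases List.mem_cons.1 hmem with rfl | hmem
  · omega
  · have := h.dist_lt c hmem
    omega

lemma self_notMem (h : Tracking P root j s L v rest) : v ∉ rest := fun hv => by
  have := h.dist_lt v hv
  omega

lemma lt_dist (h : Tracking P root j s L v rest) : j < s.dist v root := by
  obtain ⟨u, hu, -, hd⟩ := h.last
  rcases List.mem_cons.1 (List.mem_of_getLast? hu) with rfl | hmem
  · omega
  · have := h.dist_lt u hmem
    omega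

lemma lt_level (h : Tracking P root j s L v rest) : j < level root s :=
  h.lt_dist.trans_le h.desc.dist_le

lemma v_mem (h : Tracking P root j s L v rest) : v ∈ s.tree.verts := by
  rcases Relation.ReflTransGen.cases_head h.desc with h1 | ⟨w, h1, -⟩
  · exact h1 ▸ s.walker_mem
  · exact s.tree.edge_vert h1.1

lemma eq_of_mem_cand (h : Tracking P root j s L v rest) {a a' : ℕ} (h1 : c ∈ L.cand a)
    (h2 : c ∈ L.cand a') : a = a' :=
  (h.child a c h1).parent_unique h.root_mem (h.child a' c h2)

lemma ne_of_mem_cand (h : Tracking P root j s L v rest) {a : ℕ} (h1 : c ∈ L.cand a) : c ≠ a := by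
  rintro rfl
  have := (h.child c c h1).2
  omega

lemma valIn_nonneg (h : Tracking P root j s L v rest) (u : ℕ) : 0 ≤ P.valIn L u := by
  unfold Params.valIn
  split_ifs with hu
  · exact Params.birth_nonneg (h.card_le u hu) hu
  · exact race_nonneg fun c _ => h.nonneg c

lemma valAway_nonneg (h : Tracking P root j s L v rest) (u : ℕ) : 0 ≤ P.valAway L u := by
  unfold Params.valAway
  split_ifs with hu
  · exact Params.birth_nonneg (h.card_le u hu) hu
  · exact race_nonneg fun c _ => h.nonneg c

lemma setVal_nonneg (hL : ∀ u, 0 ≤ L.val u) {z : ℝ} (hz : 0 ≤ z) (u : ℕ) :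
    0 ≤ (L.setVal v z).val u := by
  unfold Labels.setVal
  by_cases hu : u = v
  · simp [hu, hz]
  · simp [hu, hL u]

lemma lift_nonneg (h : Tracking P root j s L v rest) {z : ℝ} (hz : 0 ≤ z) :
    0 ≤ P.lift L v rest z := by
  have key : ∀ (rest : List ℕ) (v : ℕ) (z : ℝ), 0 ≤ z → 0 ≤ P.lift L v rest z := by
    intro rest
    induction rest with
    | nil => exact fun v z hz => hz
    | cons u rest ih =>
      intro v z hz
      refine ih u _ ?_
      unfold Params.valIn
      split_ifs with hu
      · exact Params.birth_nonneg (h.card_le u hu) hu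
      · exact race_nonneg fun c _ => setVal_nonneg h.nonneg hz c
  exact key rest v z hz

/-- No return to the parent is left, so the race is over; the recorded children entered `M` times
have finished their visits and carry the value `1`. -/
lemma valAway_eq_one (h : Tracking P root j s L v rest) (hv : L.count v = P.M) :
    P.valAway L v = 1 := by
  unfold Params.valAway
  rw [if_neg (by have := P.b_lt; omega), hv, Nat.sub_self, race_zero]
  refine Finset.prod_eq_one fun c hc => ?_
  rw [Finset.mem_filter] at hc
  refine h.done c (h.notMem_of_lt ?_) (le_antisymm (h.count_le c) hc.2)
  rw [(h.child v c hc.1).2]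
  omega

lemma grow (h : Tracking P root j s L v rest) : Tracking P root j s.grow L v rest where
  root_mem := root_mem_grow h.root_mem
  child u c hc := (h.child u c hc).grow h.root_mem
  fresh := h.fresh
  card_le := h.card_le
  nonneg := h.nonneg
  count_le := h.count_le
  away := h.away
  done := h.done
  unused u hu := h.unused u fun hu' => hu (s.mem_verts_grow.2 (Or.inl hu'))
  chain := h.chain
  busy := h.busy
  last := by
    obtain ⟨u, hu, h1, h2⟩ := h.last
    refine ⟨u, hu, h1, ?_⟩
    rw [s.dist_grow h.root_mem, h2]
    -- The vertex lies in the tree because unused numbers have count `0`, while this one has count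
    -- `M`.
    by_contra hmem
    have := P.b_lt
    have := (h.unused u hmem).1
    omega
  desc := h.desc.grow h.root_mem

lemma moveTo (h : Tracking P root j s L v rest) {y : ℕ} (hy : y ∈ s.targets)
    (hd : IsDescendant root s v y) : Tracking P root j (s.moveTo y) L v rest where
  root_mem := root_mem_moveTo h.root_mem y
  child u c hc := isChild_moveTo.2 (h.child u c hc)
  fresh := h.fresh
  card_le := h.card_le
  nonneg := h.nonneg
  count_le := h.count_le
  away := h.away
  done := h.done
  unused u hu := h.unused u (by rwa [tree_moveTo] at hu)
  chain := h.chain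
  busy := h.busy
  last := by simpa only [dist_moveTo] using h.last
  desc := by rwa [s.walker_moveTo_of_mem hy, isDescendant_moveTo]

/-- On departure the value of `v` between visits is stored as its label. Only the value of `u` reads
this label, because `u` is the sole vertex for which `v` is recorded. -/
lemma exit (h : Tracking P root j s L v (u :: rest)) (hu : u ∈ s.targets) :
    Tracking P root j (s.moveTo u) (L.setVal v (P.valAway L v)) u rest := by
  have hvu : v ∈ L.cand u := (List.isChain_cons_cons.1 h.chain).1
  have hbu := h.busy u List.mem_cons_self
  have hval : ∀ c, c ≠ v → (L.setVal v (P.valAway L v)).val c = L.val c := fun c hc => by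
    simp [Labels.setVal, hc]
  have hself : (L.setVal v (P.valAway L v)).val v = P.valAway L v := by simp [Labels.setVal]
  have haway : ∀ c, c ≠ u → P.valAway (L.setVal v (P.valAway L v)) c = P.valAway L c := by
    intro c hc
    refine Params.valAway_congr rfl rfl fun x hx => ⟨rfl, hval x ?_⟩
    rintro rfl
    exact hc (h.eq_of_mem_cand hx hvu)
  have hne : v ≠ u := h.ne_of_mem_cand hvu
  refine ⟨root_mem_moveTo h.root_mem u, fun a c hc => isChild_moveTo.2 (h.child a c hc), ?_,
    h.card_le, setVal_nonneg h.nonneg (h.valAway_nonneg v), h.count_le, ?_, ?_, ?_,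
    (List.isChain_cons_cons.1 h.chain).2, fun x hx => h.busy x (List.mem_cons_of_mem _ hx), ?_, ?_⟩
  · intro a ha c hc
    have hcv : c ≠ v := by
      rintro rfl
      have : a = u := h.eq_of_mem_cand hc hvu
      subst this
      exact absurd hbu (not_lt.2 ha)
    rw [hval c hcv]
    exact h.fresh a ha c hc
  · intro c hc
    have hcu : c ≠ u := fun hcu => hc (hcu ▸ List.mem_cons_self)
    rw [haway c hcu]
    by_cases hcv : c = v
    · rw [hcv, hself]
    · rw [hval c hcv]
      exact h.away c fun hmem => (List.mem_cons.1 hmem).elim hcv hc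
  · intro c hc hcM
    by_cases hcv : c = v
    · subst hcv
      rw [hself]
      exact h.valAway_eq_one hcM
    · rw [hval c hcv]
      exact h.done c (fun hmem => (List.mem_cons.1 hmem).elim hcv hc) hcM
  · intro x hx
    rw [tree_moveTo] at hx
    rw [hval x fun hxv => hx (hxv ▸ h.v_mem)]
    exact h.unused x hx
  · obtain ⟨w, hw, h1⟩ := h.last
    rw [List.getLast?_cons_cons] at hw
    exact ⟨w, hw, h1.1, by rw [dist_moveTo]; exact h1.2⟩
  · rw [s.walker_moveTo_of_mem hu]
    exact Relation.ReflTransGen.refl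

lemma lift_exit (h : Tracking P root j s L v (u :: rest)) (z : ℝ) :
    P.lift (L.setVal v z) u rest (P.valIn (L.setVal v z) u) = P.lift L v (u :: rest) z := by
  rw [Params.lift]
  refine (Params.lift_congr (L := L) (L' := L.setVal v z)
    (fun x hx => ⟨rfl, rfl, fun c hc => ⟨rfl, ?_⟩⟩) _).symm
  have hvu : v ∈ L.cand u := (List.isChain_cons_cons.1 h.chain).1
  have hcv : c ≠ v := by
    rintro rfl
    have hxu : x = u := h.eq_of_mem_cand hc hvu
    subst hxu
    have hp := (List.isChain_cons_cons.1 h.chain).2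
    have h1 : (x :: rest).IsChain fun a u => s.dist u root < s.dist a root :=
      hp.imp fun a u hau => by
        rw [(h.child u a hau).2]
        omega
    have : IsTrans ℕ fun a u => s.dist u root < s.dist a root := ⟨fun _ _ _ h h' => h'.trans h⟩
    exact lt_irrefl _ ((List.pairwise_cons.1 h1.pairwise).1 x hx)
  simp [Labels.setVal, hcv]

lemma enter (h : Tracking P root j s L v rest) (hc : c ∈ L.cand v) (hcM : L.count c < P.M)
    (hv : P.b < L.count v) (hct : c ∈ s.targets) :
    Tracking P root j (s.moveTo c) (L.enter c) c (v :: rest) := by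
  have hcnt : ∀ x, x ≠ c → (L.enter c).count x = L.count x := fun x hx => by
    simp [Labels.enter, hx]
  have hself : (L.enter c).count c = L.count c + 1 := by simp [Labels.enter]
  have hnm : c ∉ v :: rest := h.notMem_of_lt (by rw [(h.child v c hc).2]; omega)
  refine ⟨root_mem_moveTo h.root_mem c, fun a x hx => isChild_moveTo.2 (h.child a x hx), ?_, ?_,
    h.nonneg, ?_, ?_, ?_, ?_, List.isChain_cons_cons.2 ⟨hc, h.chain⟩, ?_, ?_, ?_⟩
  · intro a ha x hx
    have ha' : L.count a ≤ P.b := by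
      by_cases hac : a = c
      · subst hac
        rw [hself] at ha
        omega
      · rwa [hcnt a hac] at ha
    have hxc : x ≠ c := by
      rintro rfl
      have := h.eq_of_mem_cand hx hc
      subst this
      omega
    rw [hcnt x hxc]
    exact h.fresh a ha' x hx
  · intro a ha
    by_cases hac : a = c
    · subst hac
      rw [hself] at ha ⊢
      exact (h.card_le a (by omega)).trans (Nat.le_succ _)
    · rw [hcnt a hac] at ha ⊢
      exact h.card_le a ha
  · intro a
    by_cases hac : a = c
    · subst hac
      rw [hself]
      omega
    · rw [hcnt a hac]
      exact h.count_le a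
  · intro x hx
    rw [List.mem_cons, not_or] at hx
    rw [Params.valAway_congr (L' := L) (hcnt x hx.1) rfl fun z hz => ⟨hcnt z ?_, rfl⟩]
    · exact h.away x hx.2
    · rintro rfl
      exact hx.2 (h.eq_of_mem_cand hz hc ▸ List.mem_cons_self)
  · intro x hx hxM
    rw [List.mem_cons, not_or] at hx
    rw [hcnt x hx.1] at hxM
    exact h.done x hx.2 hxM
  · intro x hx
    rw [tree_moveTo] at hx
    rw [hcnt x fun hxc => hx (hxc ▸ s.targets_subset_verts hct)]
    exact h.unused x hx
  · intro x hx
    rw [hcnt x fun hxc => hnm (hxc ▸ hx)]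
    rcases List.mem_cons.1 hx with rfl | hx
    · exact hv
    · exact h.busy x hx
  · obtain ⟨w, hw, h1⟩ := h.last
    refine ⟨w, by rwa [List.getLast?_cons_cons], ?_⟩
    rw [hcnt w fun hwc => hnm (hwc ▸ List.mem_of_getLast? hw)]
    simpa only [dist_moveTo] using h1
  · rw [s.walker_moveTo_of_mem hct]
    exact Relation.ReflTransGen.refl

/-- Putting `c` in front of the path inserts `z` for the label of `c` in the race at `v`; as `z ≤
L.val c`, monotonicity gives the bound by the race in which `c` has just scored. -/
lemma lift_enter_le (h : Tracking P root j s L v rest) (hc : c ∈ L.cand v)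
    (hv : P.b < L.count v) {z : ℝ} (hz0 : 0 ≤ z) (hz : z ≤ L.val c) :
    P.lift (L.enter c) c (v :: rest) z ≤ P.lift L v rest (race P.M (P.M - L.count v + 1) (L.cand v)
      (Function.update L.count c (L.count c + 1)) L.val) := by
  have hcnt : ∀ x, x ≠ c → (L.enter c).count x = L.count x := fun x hx => by
    simp [Labels.enter, hx]
  have hnm : c ∉ v :: rest := h.notMem_of_lt (by rw [(h.child v c hc).2]; omega)
  rw [List.mem_cons, not_or] at hnm
  rw [Params.lift, Params.lift_congr (L' := L)]
  · refine Params.lift_mono h.nonneg v rest ?_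
    have h1 : ((L.enter c).setVal c z).count v = L.count v := hcnt v (Ne.symm hnm.1)
    unfold Params.valIn
    rw [h1, if_neg (not_le.2 hv)]
    refine race_mono (fun x _ => setVal_nonneg (L := L.enter c) h.nonneg hz0 x) fun x _ => ?_
    by_cases hxc : x = c
    · simpa [Labels.setVal, hxc] using hz
    · simp [Labels.setVal, Labels.enter, hxc]
  · intro x hx
    refine ⟨hcnt x fun hxc => hnm.2 (hxc ▸ hx), rfl, fun y hy => ⟨hcnt y ?_, rfl⟩⟩
    rintro rfl
    exact h.self_notMem (h.eq_of_mem_cand hy hc ▸ hx)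

/-- The newborn was an unused number, so its labels are those of a fresh vertex. The strict
inequality leaves room for one more recorded child. -/
lemma addCand (h : Tracking P root j s L v rest) (hw : s.walker = v) (hv : L.count v ≤ P.b)
    (hcard : (L.cand v).card < L.count v) :
    Tracking P root j s.grow (L.addCand v s.newVertex) v rest := by
  have hg := h.grow
  have hcand : ∀ x, x ≠ v → (L.addCand v s.newVertex).cand x = L.cand x := fun x hx => by
    simp [Labels.addCand, hx]
  have hself : (L.addCand v s.newVertex).cand v = insert s.newVertex (L.cand v) := by
    simp [Labels.addCand]
  have hsub : ∀ x, L.cand x ⊆ (L.addCand v s.newVertex).cand x := by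
    intro x
    by_cases hx : x = v
    · subst hx
      rw [hself]
      exact Finset.subset_insert _ _
    · rw [hcand x hx]
  have hmem : ∀ a c, c ∈ (L.addCand v s.newVertex).cand a →
      c ∈ L.cand a ∨ (a = v ∧ c = s.newVertex) := by
    intro a c hc
    by_cases ha : a = v
    · subst ha
      rw [hself, Finset.mem_insert] at hc
      tauto
    · rw [hcand a ha] at hc
      exact Or.inl hc
  have hnew := h.unused _ s.newVertex_notMem
  refine ⟨hg.root_mem, ?_, ?_, ?_, h.nonneg, h.count_le, ?_, h.done, ?_,
    h.chain.imp fun a u hau => hsub u hau, h.busy, hg.last, hg.desc⟩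
  · intro a c hc
    rcases hmem a c hc with hc | ⟨rfl, rfl⟩
    · exact hg.child a c hc
    · exact hw ▸ isChild_newVertex h.root_mem
  · intro a ha c hc
    rcases hmem a c hc with hc | ⟨rfl, rfl⟩
    · exact h.fresh a ha c hc
    · exact ⟨hnew.1, hnew.2.2⟩
  · intro a ha
    by_cases hav : a = v
    · subst hav
      rw [hself]
      exact (Finset.card_insert_le _ _).trans hcard
    · rw [hcand a hav]
      exact h.card_le a ha
  · intro c hc
    have hcv : c ≠ v := fun hcv => hc (hcv ▸ List.mem_cons_self)
    rw [Params.valAway_congr (L := L.addCand v s.newVertex) (L' := L) rfl (hcand c hcv)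
      fun _ _ => ⟨rfl, rfl⟩]
    exact h.away c hc
  · intro x hx
    have hxv : x ≠ v := fun hxv => hx (hxv ▸ hg.v_mem)
    rw [hcand x hxv]
    exact hg.unused x hx

lemma lift_addCand (h : Tracking P root j s L v rest) (c : ℕ) (z : ℝ) :
    P.lift (L.addCand v c) v rest z = P.lift L v rest z := by
  refine (Params.lift_congr (L := L) (L' := L.addCand v c)
    (fun x hx => ⟨rfl, ?_, fun _ _ => ⟨rfl, rfl⟩⟩) z).symm
  have hxv : x ≠ v := fun hxv => h.self_notMem (hxv ▸ hx)
  simp [Labels.addCand, hxv]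

/-- An entry uses up one return to the parent and opens another one, so the race is unchanged. At
count `b` the formula passes from `birth` to `race`: all recorded children are fresh, and
`race_const_le` gives exactly the value `birth`. -/
lemma valIn_enter_le (h : Tracking P root j s L v rest) (hc : c ∉ v :: rest)
    (hcc : c ∉ L.cand c) (hb : P.b ≤ L.count c) (hM : L.count c < P.M) :
    P.valIn (L.enter c) c ≤ L.val c := by
  have hself : (L.enter c).count c = L.count c + 1 := by simp [Labels.enter]
  have hcnt : ∀ x ∈ L.cand c, (L.enter c).count x = L.count x := fun x hx => by
    have hxc : x ≠ c := by
      rintro rfl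
      exact hcc hx
    simp [Labels.enter, hxc]
  refine le_trans ?_ (h.away c hc)
  unfold Params.valIn Params.valAway
  rw [hself, if_neg (by omega), show P.M - (L.count c + 1) + 1 = P.M - L.count c by omega]
  change race P.M (P.M - L.count c) (L.cand c) (L.enter c).count L.val ≤ _
  rw [race_congr (t' := L.count) (y' := L.val) hcnt fun _ _ => rfl]
  split_ifs with hle
  · have hbe : L.count c = P.b := le_antisymm hle hb
    have hfr := h.fresh c hle
    have hcard := h.card_le c hle
    rw [race_congr (t' := fun _ => 0) (y' := fun _ => 1 - P.r) (fun x hx => (hfr x hx).1)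
      fun x hx => (hfr x hx).2, hbe]
    have hr : ((L.cand c).card : ℝ) * P.r ≤ 1 := by
      refine le_trans ?_ P.b_mul_r
      have := P.r_pos
      gcongr
      omega
    refine (race_const_le P.r_pos.le P.r_le hr).trans (le_of_eq ?_)
    simp only [Params.birth, Nat.sub_zero, Finset.sum_const, nsmul_eq_mul]
    ring
  · exact le_rfl

end Tracking

end BGRW

/-! ### Bound on hitting probabilities by the labels, and uniform escape. -/

namespace BGRW

open State

variable {p : unitInterval} {P : Params p} {L : Labels} {root j n : ℕ} {s : State} {v : ℕ}
  {rest : List ℕ}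

/-- The bound on hitting probabilities by the value of the labels, in the course of a visit. -/
def VisitBound (P : Params p) (n : ℕ) : Prop :=
  ∀ (root j : ℕ) (s : State) (L : Labels) (v : ℕ) (rest : List ℕ), Tracking P root j s L v rest →
    hitProb p root j n s ≤ ENNReal.ofReal (P.lift L v rest (P.valIn L v))

/-- The bound on hitting probabilities by the value of the labels, at an early entry. -/
def EntryBound (P : Params p) (n : ℕ) : Prop :=
  ∀ (root j : ℕ) (s : State) (L : Labels) (v : ℕ) (rest : List ℕ) (k : ℕ),
    Tracking P root j s L v rest → s.walker = v → L.count v = k + 1 → k + 1 ≤ P.b →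
    (L.cand v).card ≤ k →
    hitProb p root j n s ≤ ENNReal.ofReal (P.lift L v rest (P.birth k (L.cand v).card))

lemma hitProb_le_of_enter (hA : VisitBound P n) (hB : EntryBound P n)
    (h : Tracking P root j s L v rest) {c : ℕ} (hc : c ∈ L.cand v) (hcM : L.count c < P.M)
    (hv : P.b < L.count v) (hct : c ∈ s.targets) :
    hitProb p root j n (s.moveTo c) ≤ ENNReal.ofReal (P.lift L v rest (race P.M
      (P.M - L.count v + 1) (L.cand v) (Function.update L.count c (L.count c + 1)) L.val)) := by
  have hT := h.enter hc hcM hv hct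
  have hnm : c ∉ v :: rest := h.notMem_of_lt (by rw [(h.child v c hc).2]; omega)
  have hself : (L.enter c).count c = L.count c + 1 := by simp [Labels.enter]
  rcases le_or_gt P.b (L.count c) with hb | hb
  · refine (hA root j _ _ _ _ hT).trans (ENNReal.ofReal_le_ofReal ?_)
    refine h.lift_enter_le hc hv (hT.valIn_nonneg c) (h.valIn_enter_le hnm ?_ hb hcM)
    exact fun hcc => h.ne_of_mem_cand hcc rfl
  · have hcard := h.card_le c hb.le
    refine (hB root j _ _ _ _ (L.count c) hT (s.walker_moveTo_of_mem hct) hself hb hcard).trans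
      (ENNReal.ofReal_le_ofReal ?_)
    refine h.lift_enter_le hc hv (Params.birth_nonneg hcard hb.le) ?_
    have := h.away c hnm
    rwa [Params.valAway, if_pos hb.le] at this

lemma hitProb_le_of_exit (hA : VisitBound P n) (h : Tracking P root j s L v rest)
    {w : ℕ} (hwv : IsChild root s w v) (hwt : w ∈ s.targets) :
    hitProb p root j n (s.moveTo w) ≤ ENNReal.ofReal (P.lift L v rest (P.valAway L v)) := by
  cases rest with
  | nil =>
    -- The walker leaves the last vertex of the path, at level `j + 1`, in its visit number `M`: the
    -- value is `1` and the bound is trivial.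
    obtain ⟨u, hu, h1, -⟩ := h.last
    have huv : u = v := by simpa using hu.symm
    rw [Params.lift, h.valAway_eq_one (huv ▸ h1), ENNReal.ofReal_one]
    exact hitProb_le_one
  | cons u rest =>
    have hvu : v ∈ L.cand u := (List.isChain_cons_cons.1 h.chain).1
    have hwu : w = u := hwv.parent_unique h.root_mem (h.child u v hvu)
    subst hwu
    rw [← h.lift_exit]
    exact hA root j _ _ _ _ (h.exit hwt)

/-- Away from `v` no label changes. At `v` the possible moves are the rounds of the race, and its
recursion makes the value a martingale; moves to other children are rounds that do not count. -/
lemma lintegral_jumpKernel_hitProb_le (hA : VisitBound P n) (hB : EntryBound P n)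
    (h : Tracking P root j s L v rest) :
    ∫⁻ s', hitProb p root j n s' ∂(jumpKernel s) ≤
      ENNReal.ofReal (P.lift L v rest (P.valIn L v)) := by
  classical
  have hlev : s.dist s.walker root ≠ 0 := by
    have : j < s.dist s.walker root := h.lt_level
    omega
  obtain ⟨w, hw, hwd⟩ := s.exists_parent h.root_mem s.walker_mem hlev
  have hwc : IsChild root s w s.walker := ⟨hw.symm, hwd⟩
  have htar : ∀ {y}, y ∈ s.targets ↔ s.tree.Adj s.walker y := s.mem_targets_iff_of_adj hw
  have hcase : ∀ y ∈ s.targets, y = w ∨ IsChild root s s.walker y := fun y hy => by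
    rcases isChild_or_of_adj h.root_mem (htar.1 hy) with h1 | h1
    · exact Or.inr h1
    · exact Or.inl (h1.parent_unique h.root_mem hwc)
  have hstay : ∀ y ∈ s.targets, IsDescendant root s v y →
      hitProb p root j n (s.moveTo y) ≤ ENNReal.ofReal (P.lift L v rest (P.valIn L v)) :=
    fun y hy hd => hA root j _ _ _ _ (h.moveTo hy hd)
  have hchild : ∀ y, IsChild root s s.walker y → IsDescendant root s v y :=
    fun y hy => Relation.ReflTransGen.tail h.desc hy
  have hconst : (∀ y ∈ s.targets, hitProb p root j n (s.moveTo y) ≤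
      ENNReal.ofReal (P.lift L v rest (P.valIn L v))) → ∫⁻ s', hitProb p root j n s' ∂(jumpKernel s)
        ≤ ENNReal.ofReal (P.lift L v rest (P.valIn L v)) := fun hy =>
    lintegral_jumpKernel_le s (measurable_hitProb ..)
      (A := fun _ => P.lift L v rest (P.valIn L v)) hy
      (fun _ _ => h.lift_nonneg (h.valIn_nonneg v)) (by rw [Finset.sum_const, nsmul_eq_mul])
  by_cases hwv : s.walker = v
  swap
  · refine hconst fun y hy => hstay y hy ?_
    rcases hcase y hy with rfl | hy'
    · exact h.desc.parent h.root_mem hwv hwc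
    · exact hchild y hy'
  have hexit : hitProb p root j n (s.moveTo w) ≤
      ENNReal.ofReal (P.lift L v rest (P.valAway L v)) :=
    hitProb_le_of_exit hA h (hwv ▸ hwc) (htar.2 hw)
  rcases le_or_gt (L.count v) P.b with hb | hb
  -- During the early visits the value is the same inside and between visits, so a return to the
  -- parent costs nothing and entries into children need not be recorded.
  · refine hconst fun y hy => ?_
    rcases hcase y hy with rfl | hy'
    · simp only [Params.valIn, Params.valAway, if_pos hb] at hexit ⊢
      exact hexit
    · exact hstay y hy (hchild y hy')
  · set act := (L.cand v).filter fun c => L.count c < P.M with hact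
    set k := P.M - L.count v with hk
    set R : (ℕ → ℕ) → ℝ := fun t => race P.M (k + 1) (L.cand v) t L.val with hR
    -- The value at `v` after the move to `y`: the parent scores, an active recorded child scores,
    -- or nothing is counted.
    set z : ℕ → ℝ := fun y => if y = w then P.valAway L v else
      if y ∈ act then R (Function.update L.count y (L.count y + 1)) else P.valIn L v with hz
    have hin : P.valIn L v = R L.count := by
      rw [Params.valIn, if_neg (not_le.2 hb)]
    have haway : P.valAway L v = race P.M k (L.cand v) L.count L.val := by
      rw [Params.valAway, if_neg (not_le.2 hb)]
    have hz0 : ∀ y, 0 ≤ z y := by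
      intro y
      rw [hz]
      dsimp only
      split_ifs
      · exact h.valAway_nonneg v
      · exact race_nonneg fun c _ => h.nonneg c
      · exact h.valIn_nonneg v
    have hwact : w ∉ act := fun hmem => by
      have h1 := (h.child v w (Finset.mem_filter.1 hmem).1).2
      rw [← hwv, hwd] at h1
      omega
    have hsub : act ⊆ s.targetsFinset.erase w := fun c hc => by
      rw [Finset.mem_erase, mem_targetsFinset, htar]
      refine ⟨fun hcw => hwact (hcw ▸ hc), ?_⟩
      have h1 := (h.child v c (Finset.mem_filter.1 hc).1).1
      rwa [hwv]
    have hwmem : w ∈ s.targetsFinset := s.mem_targetsFinset.2 (htar.2 hw)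
    obtain ⟨A, B, hB0, hAB⟩ := Params.lift_affine (P := P) h.nonneg v rest
    refine lintegral_jumpKernel_le s (measurable_hitProb ..)
      (A := fun y => P.lift L v rest (z y)) (fun y hy => ?_)
      (fun y _ => h.lift_nonneg (hz0 y)) ?_
    · rw [hz]
      dsimp only
      split_ifs with h1 h2
      · exact h1 ▸ hexit
      · rw [hact, Finset.mem_filter] at h2
        exact hitProb_le_of_enter hA hB h h2.1 h2.2 hb hy
      · exact hstay y hy (hchild y ((hcase y hy).resolve_left h1))
    · have hsum : ∑ y ∈ s.targetsFinset, z y = s.targetsFinset.card * P.valIn L v := by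
        have h1 : ∑ y ∈ s.targetsFinset.erase w, z y =
            ∑ y ∈ act, R (Function.update L.count y (L.count y + 1)) +
              (s.targetsFinset.card - 1 - act.card) * P.valIn L v := by
          rw [← Finset.sum_sdiff hsub, add_comm]
          congr 1
          · refine Finset.sum_congr rfl fun y hy => ?_
            rw [hz]
            dsimp only
            rw [if_neg (show y ≠ w by rintro rfl; exact hwact hy), if_pos hy]
          · have h2 : ∀ y ∈ s.targetsFinset.erase w \ act, z y = P.valIn L v := fun y hy => by
              rw [Finset.mem_sdiff, Finset.mem_erase] at hy
              rw [hz]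
              dsimp only
              rw [if_neg hy.1.1, if_neg hy.2]
            have h3 : (s.targetsFinset.erase w \ act).card + act.card + 1 =
                s.targetsFinset.card := by
              rw [Finset.card_sdiff_add_card_eq_card hsub, Finset.card_erase_add_one hwmem]
            rw [Finset.sum_congr rfl h2, Finset.sum_const, nsmul_eq_mul, ← h3]
            push_cast
            ring
        have h4 : z w = P.valAway L v := by
          rw [hz]
          dsimp only
          rw [if_pos rfl]
        have h5 : ((act.card : ℝ) + 1) * R L.count = race P.M k (L.cand v) L.count L.val +
            ∑ c ∈ act, R (Function.update L.count c (L.count c + 1)) := race_succ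
        rw [← Finset.add_sum_erase _ _ hwmem, h1, h4, haway, hin]
        linarith
      simp only [hAB]
      rw [Finset.sum_add_distrib, Finset.sum_const, nsmul_eq_mul, ← Finset.mul_sum, hsum]
      apply le_of_eq
      ring

/-- The two bounds need a joint induction: a jump from `v` may be an early entry into a child, whose
value still averages over the birth in the next step. -/
lemma visitBound_and_entryBound (P : Params p) (n : ℕ) : VisitBound P n ∧ EntryBound P n := by
  have hp0 := p.2.1
  have hp1 := p.2.2
  induction n with
  | zero =>
    constructor
    · intro root j s L v rest h
      simp [hitProb, not_le.2 h.lt_level]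
    · intro root j s L v rest k h
      simp [hitProb, not_le.2 h.lt_level]
  | succ n ih =>
    obtain ⟨hA, hB⟩ := ih
    constructor
    · intro root j s L v rest h
      have h0 := h.lift_nonneg (h.valIn_nonneg v)
      rw [hitProb_succ_of_lt h.lt_level]
      -- A birth here is not recorded, so both outcomes of the growth have the same bound.
      refine lintegral_stepKernel_le p s (measurable_hitProb ..)
        (lintegral_jumpKernel_hitProb_le hA hB h.grow)
        (lintegral_jumpKernel_hitProb_le hA hB h) h0 h0 (le_of_eq ?_)
      ring
    · intro root j s L v rest k h hw hk hkb hcard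
      -- Here a birth is recorded, and the two outcomes average to the claimed value by
      -- `birth_step`.
      have hT := h.addCand hw (hk.trans_le hkb) (by omega)
      have h0 := h.lift_nonneg (h.valIn_nonneg v)
      have h1 := hT.lift_nonneg (hT.valIn_nonneg v)
      rw [hitProb_succ_of_lt h.lt_level]
      refine lintegral_stepKernel_le p s (measurable_hitProb ..)
        (lintegral_jumpKernel_hitProb_le hA hB hT)
        (lintegral_jumpKernel_hitProb_le hA hB h) h1 h0 (le_of_eq ?_)
      rw [h.lift_addCand]
      obtain ⟨A, B, hB0, hAB⟩ := Params.lift_affine (P := P) h.nonneg v rest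
      have hv1 : P.valIn L v = P.birth (k + 1) (L.cand v).card := by
        rw [Params.valIn, hk, if_pos hkb]
      have hnew : s.newVertex ∉ L.cand v := fun hmem => by
        exact s.newVertex_notMem (s.tree.edge_vert (h.child v _ hmem).1.symm)
      have hv2 : P.valIn (L.addCand v s.newVertex) v =
          P.birth (k + 1) ((L.cand v).card + 1) := by
        have h2 : (L.addCand v s.newVertex).count v = k + 1 := hk
        have h3 : ((L.addCand v s.newVertex).cand v).card = (L.cand v).card + 1 := by
          simp [Labels.addCand, Finset.card_insert_of_notMem hnew]
        rw [Params.valIn, h2, h3, if_pos hkb]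
      rw [hAB, hAB, hAB, hv1, hv2, ← Params.birth_step k]
      ring

/-- The initial labels: only `c` is recorded as a child of `a`, which is in its last visit. -/
def initialLabels (P : Params p) (a c : ℕ) : Labels where
  count := Function.update (fun _ => 0) a P.M
  cand := Function.update (fun _ => ∅) a {c}
  val := fun _ => 1 - P.r

lemma tracking_initialLabels (P : Params p) {a c : ℕ} (hroot : root ∈ s.tree.verts)
    (hac : IsChild root s a c) (ha : s.dist a root = j + 1) (hd : IsDescendant root s a s.walker) :
    Tracking P root j s (initialLabels P a c) a [] := by
  have hb := P.b_lt
  have hr := P.r_le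
  have ha0 : (initialLabels P a c).count a = P.M := by simp [initialLabels]
  have ha1 : (initialLabels P a c).cand a = {c} := by simp [initialLabels]
  have hx0 : ∀ x, x ≠ a → (initialLabels P a c).count x = 0 := fun x hx => by
    simp [initialLabels, hx]
  have hx1 : ∀ x, x ≠ a → (initialLabels P a c).cand x = ∅ := fun x hx => by
    simp [initialLabels, hx]
  have hmem : a ∈ s.tree.verts := s.tree.edge_vert hac.1
  refine ⟨hroot, ?_, ?_, ?_, fun u => sub_nonneg.2 hr, ?_, ?_, ?_, ?_, List.isChain_singleton _,
    by simp, ⟨a, by simp, ha0, ha⟩, hd⟩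
  · intro u x hx
    by_cases hu : u = a
    · subst hu
      rw [ha1, Finset.mem_singleton] at hx
      exact hx ▸ hac
    · simp [hx1 u hu] at hx
  · intro u hu x hx
    have hua : u ≠ a := by
      rintro rfl
      omega
    simp [hx1 u hua] at hx
  · intro u hu
    have hua : u ≠ a := by
      rintro rfl
      omega
    simp [hx1 u hua]
  · intro u
    by_cases hu : u = a
    · rw [hu, ha0]
    · simp [hx0 u hu]
  · intro x hx
    have hxa : x ≠ a := by simpa using hx
    rw [Params.valAway, hx0 x hxa, hx1 x hxa, if_pos (Nat.zero_le _)]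
    exact Params.birth_zero_le
  · intro x hx hxM
    have hxa : x ≠ a := by simpa using hx
    rw [hx0 x hxa] at hxM
    omega
  · intro x hx
    have hxa : x ≠ a := fun h => hx (h ▸ hmem)
    exact ⟨hx0 x hxa, hx1 x hxa, rfl⟩

/-- Treat `a` as being in its visit number `M`, with the walker's position as its single recorded
child. This child must score `M` times before the parent scores once; its present visit is not
counted. -/
lemma hitProb_le_of_child (P : Params p) {a : ℕ} (hroot : root ∈ s.tree.verts)
    (hac : IsChild root s a s.walker) (ha : s.dist a root = j + 1) :
    hitProb p root j n s ≤ ENNReal.ofReal (1 - P.r / 2 * fairRace P.M 1) := by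
  have hT := tracking_initialLabels P hroot hac ha (Relation.ReflTransGen.single hac)
  refine ((visitBound_and_entryBound P n).1 _ _ _ _ _ _ hT).trans (ENNReal.ofReal_le_ofReal ?_)
  have hb := P.b_lt
  have hne : s.walker ≠ a := hT.ne_of_mem_cand (by simp [initialLabels])
  have ha0 : (initialLabels P a s.walker).count a = P.M := by simp [initialLabels]
  have ha1 : (initialLabels P a s.walker).cand a = {s.walker} := by simp [initialLabels]
  rw [Params.lift, Params.valIn, ha0, ha1, if_neg (by omega), Nat.sub_self, zero_add]
  refine (race_const_le (S := {s.walker}) P.r_pos.le P.r_le (by simpa using P.r_le)).trans ?_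
  simp [initialLabels, hne]

/-- With probability at least `p / 2` the first step leads to a child, from where the previous lemma
applies. -/
lemma uniformEscape (P : Params p) : UniformEscape p (p * (P.r / 2 * fairRace P.M 1) / 2) := by
  have h0 := P.r_pos
  have h1 := P.r_le
  have h2 := fairRace_nonneg P.M 1
  have h3 := fairRace_le_one P.M 1
  intro root j n s hroot hs
  cases n with
  | zero => simp [hitProb, hs]
  | succ n =>
    rw [hitProb_succ_of_lt (by omega)]
    refine lintegral_stepKernel_le_of_up (measurable_hitProb ..) (fun _ => hitProb_le_one)
      (by positivity) (by nlinarith) hroot fun y hy hy' => ?_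
    have hyt : y ∈ s.grow.targets := (s.grow.mem_targets_iff_of_adj (z := y) hy).2 hy
    have hl := level_grow s hroot
    unfold level at hl hs hy'
    rw [s.walker_grow] at hl
    refine hitProb_le_of_child P (a := s.walker) (root_mem_moveTo (root_mem_grow hroot) y) ?_ ?_
    · rw [s.grow.walker_moveTo_of_mem hyt, isChild_moveTo]
      exact ⟨hy, by rw [hy', hl]⟩
    · rw [dist_moveTo, hl, hs]

end BGRW

theorem mainTheorem5 (p : unitInterval) (hp : 0 < p) :
    ∃ c : ℝ, 0 < c ∧ ∀ (s : BGRW.State) (root : ℕ), root ∈ s.tree.verts →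
      ∀ᵐ ω ∂(BGRW.law p s),
        (c : EReal) ≤ liminf
          (fun n : ℕ => ((((ω n).dist (ω n).walker root : ℝ) / (n : ℝ) : ℝ) : EReal)) atTop := by
  obtain ⟨P⟩ := BGRW.exists_params p hp
  have hp0 : (0 : ℝ) < p := hp
  have hp1 : (p : ℝ) ≤ 1 := p.2.2
  have h0 := P.r_pos
  have h1 := P.r_le
  have h2 := BGRW.fairRace_succ_pos P.M 0
  have h3 := BGRW.fairRace_le_one P.M 1
  have h4 : P.r / 2 * BGRW.fairRace P.M 1 ≤ 1 := by nlinarith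
  exact (BGRW.uniformEscape P).exists_speed hp (by positivity) (by nlinarith)
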